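/- Let $b\in\mathbb R$. For $\rho>0$ and an integer $k\ge 0$ let $H^{k,\rho}$ be the space of complex functions $f$ analytic in the strip $\{x\in\mathbb C:|\Im x|<\rho\}$ such that, for every $0\le j\le k$, $\partial_x^j f(\cdot+iy)\in L^2(\mathbb R)$ for all $|y|<\rho$ and $$|\partial_x^jf|_\rho=\sup_{|y|<\rho}\|\partial_x^jf(\cdot+iy)\|_{L^2(\mathbb R)}<\infty ,$$ with norm $\|f\|_{k,\rho}=\sum_{0\le j\le k}|\partial_x^jf|_\rho$. Let $\rho_0>0$ and $u_0\in H^{1,\rho_0}$. Then there exists $\beta>0$ such that for every $\rho$ with $0<\rho<\rho_0$, setting $T=(\rho_0-\rho)/\beta$, there exists a unique $u\in C^1([0,T],H^{1,\rho})$ (so that $u(\cdot,t)\in H^{1,\rho}$ and $\partial_tu(\cdot,t)\in H^{1,\rho}$ for all $t\in[0,T]$) which solves the $b$-family equation $$u_t-u_{txx}+(b+1)\,u\,u_x=b\,u_x\,u_{xx}+u\,u_{xxx},\qquad |\Im x|<\rho,\ t\in[0,T],$$ with initial condition $u(\cdot,0)=u_0$ in the strip $|\Im x|<\rho$. -/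

import Mathlib

open Filter Topology MeasureTheory
open scoped ENNReal

namespace BFamily

/-- The open complex strip `|Im z| < ρ`. -/
def strip (ρ : ℝ) : Set ℂ := {z : ℂ | |z.im| < ρ}

/-- `|f|_ρ = sup_{|y| < ρ} ‖f(· + i y)‖_{L²(ℝ)}`, as an extended nonnegative number. -/
noncomputable def stripNorm (ρ : ℝ) (f : ℂ → ℂ) : ℝ≥0∞ :=
  ⨆ y ∈ Set.Ioo (-ρ) ρ, eLpNorm (fun x : ℝ => f ((x : ℂ) + (y : ℂ) * Complex.I)) 2 volume

/-- `H^{0,ρ}`: functions analytic in the strip, square integrable along every horizontal line of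
the strip, with uniformly bounded `L²` norms. (Only the values in the strip matter.) -/
def MemH0 (ρ : ℝ) (f : ℂ → ℂ) : Prop :=
  DifferentiableOn ℂ f (strip ρ) ∧
  (∀ y ∈ Set.Ioo (-ρ) ρ, MemLp (fun x : ℝ => f ((x : ℂ) + (y : ℂ) * Complex.I)) 2 volume) ∧
  stripNorm ρ f < ∞

/-- `H^{k,ρ}`: functions analytic in the strip whose derivatives of order `0 ≤ j ≤ k` all lie in
`H^{0,ρ}`. -/
def MemH (k : ℕ) (ρ : ℝ) (f : ℂ → ℂ) : Prop :=
  ∀ j ≤ k, MemH0 ρ (iteratedDeriv j f)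

/-- The norm `‖f‖_{k,ρ} = ∑_{0 ≤ j ≤ k} |∂_x^j f|_ρ` of `H^{k,ρ}`. -/
noncomputable def hNorm (k : ℕ) (ρ : ℝ) (f : ℂ → ℂ) : ℝ≥0∞ :=
  ∑ j ∈ Finset.range (k + 1), stripNorm ρ (iteratedDeriv j f)

/-- `u ∈ C¹([0,T], H^{k,ρ})` with time derivative `ut`: for every `t ∈ [0,T]` both `u t` and `ut t`
lie in `H^{k,ρ}`, the difference quotients of `u` at `t` (one-sided at the end points) converge to
`ut t` in the norm of `H^{k,ρ}`, and `ut` is continuous in that norm. -/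
structure IsC1InTime (k : ℕ) (ρ T : ℝ) (u ut : ℝ → ℂ → ℂ) : Prop where
  mem : ∀ t ∈ Set.Icc 0 T, MemH k ρ (u t)
  mem_deriv : ∀ t ∈ Set.Icc 0 T, MemH k ρ (ut t)
  tendsto_quotient : ∀ t ∈ Set.Icc 0 T,
    Tendsto (fun s : ℝ => hNorm k ρ (fun z => (u s z - u t z) / ((s - t : ℝ) : ℂ) - ut t z))
      (𝓝[Set.Icc 0 T \ {t}] t) (𝓝 0)
  tendsto_deriv : ∀ t ∈ Set.Icc 0 T,
    Tendsto (fun s : ℝ => hNorm k ρ (fun z => ut s z - ut t z)) (𝓝[Set.Icc 0 T] t) (𝓝 0)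

/-- The `b`-family equation
`u_t - u_{txx} + (b + 1) u u_x = b u_x u_{xx} + u u_{xxx}`
in the strip of half-width `ρ`, for times in `[0,T]`; the space variable is complex, `∂_x` is the
complex derivative, and `ut` stands for `∂_t u`. -/
def SolvesBFamily (b ρ T : ℝ) (u ut : ℝ → ℂ → ℂ) : Prop :=
  ∀ t ∈ Set.Icc 0 T, ∀ z ∈ strip ρ,
    ut t z - iteratedDeriv 2 (ut t) z + ((b : ℂ) + 1) * u t z * deriv (u t) z
      = (b : ℂ) * deriv (u t) z * iteratedDeriv 2 (u t) z + u t z * iteratedDeriv 3 (u t) z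

/-- `u` is a solution on `[0,T]`, of class `C¹` in time with values in `H^{1,ρ}`, of the Cauchy
problem for the `b`-family equation with initial datum `u₀`. -/
def IsSolution (b ρ T : ℝ) (u₀ : ℂ → ℂ) (u : ℝ → ℂ → ℂ) : Prop :=
  ∃ ut : ℝ → ℂ → ℂ,
    IsC1InTime 1 ρ T u ut ∧ SolvesBFamily b ρ T u ut ∧ Set.EqOn (u 0) u₀ (strip ρ)

end BFamily

/-!
Inverting `1 - ∂_x²` turns the `b`-family equation into the nonlocal equation `u_t = -u u_x - ∂_x
(1 - ∂_x²)⁻¹ ((b/2) u² + ((3-b)/2) u_x²)`, whose right-hand side is a quadratic map that loses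
only one derivative: from the strip of half-width `ρ + δ` to the one of half-width `ρ` it is
bounded in `H¹` with norm `O(1 + 1/δ)` (`H1Bound.nonlocalForm`). The ingredients are Cauchy's
estimate for the norms `|·|_ρ`, the Sobolev inequality on horizontal lines, and the representation
of `(1 - ∂_x²)⁻¹` and `∂_x (1 - ∂_x²)⁻¹` by the exponential averages `(1 ∓ ∂_x)⁻¹ g (z) = ∫₀^∞
e^{-s} g(z ± s) ds`, which do not increase any of the norms.

Existence is a Cauchy–Kovalevskaya argument on the Taylor series in time `u = ∑ tⁿ cₙ`. Since the
right-hand side is quadratic, the `cₙ` satisfy a convolution recursion, and induction gives the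
majorant `‖cₙ‖_{1,ρ} ≤ M Cₙ (L / (ρ₀ - ρ))ⁿ` with the Catalan numbers `Cₙ ≤ 4ⁿ` and a constant `L`
independent of `ρ` (`h1Bound_taylorCoeff`). So the series converges, with all its derivatives, for
`t ≤ (ρ₀ - ρ) / β` when `β` is a large multiple of `L`. The local equation is then checked
coefficient by coefficient, as an identity between Cauchy products of power series.

For uniqueness, a bounded analytic `h` with `h = h''` in a strip vanishes, so every solution of
the local equation solves the nonlocal one (`eq_nonlocalForm`). The difference `v` of two
solutions then obeys `sup |v_t| ≤ (C / δ) sup |v|` with loss `δ` of the width of the strip.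
Iterating this `N` times with losses proportional to `1 / N` and letting `N → ∞` shows that `v`
vanishes for a short time on a smaller strip (`eq_zero_of_scale_estimate`), hence on the whole
strip by the identity theorem, and a connectedness argument in `t` concludes.
-/

namespace BFamily

/-! ### Strips and the two kinds of bounds -/

theorem isOpen_strip (ρ : ℝ) : IsOpen (strip ρ) :=
  isOpen_lt (continuous_abs.comp Complex.continuous_im) continuous_const

theorem strip_mono {ρ ρ' : ℝ} (h : ρ ≤ ρ') : strip ρ ⊆ strip ρ' :=
  fun _ hz => lt_of_lt_of_le hz h

theorem isPreconnected_strip (ρ : ℝ) : IsPreconnected (strip ρ) := by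
  have h : strip ρ = Complex.imLm ⁻¹' Set.Ioo (-ρ) ρ := by
    ext z
    simp [strip, abs_lt]
  rw [h]
  exact ((convex_Ioo (-ρ) ρ).linear_preimage Complex.imLm).isPreconnected

theorem line_mem_strip {ρ y : ℝ} (hy : y ∈ Set.Ioo (-ρ) ρ) (x : ℝ) :
    (x : ℂ) + (y : ℂ) * Complex.I ∈ strip ρ := by
  simpa [strip, abs_lt] using hy

theorem add_real_mem_strip {ρ : ℝ} {z : ℂ} (hz : z ∈ strip ρ) (x : ℝ) :
    z + (x : ℂ) ∈ strip ρ := by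
  simpa [strip] using hz

theorem mem_strip_of_norm_sub_le {ρ ρ' δ : ℝ} (h : ρ + δ ≤ ρ') {z w : ℂ} (hz : z ∈ strip ρ)
    (hw : ‖w - z‖ ≤ δ) : w ∈ strip ρ' := by
  have h1 := (Complex.abs_im_le_norm (w - z)).trans hw
  have h2 : |w.im| ≤ |z.im| + |(w - z).im| := by
    have := abs_add_le z.im (w - z).im
    simpa using this
  have h3 : |z.im| < ρ := hz
  change |w.im| < ρ'
  linarith

theorem im_mem_Ioo {ρ : ℝ} {z : ℂ} (hz : z ∈ strip ρ) : z.im ∈ Set.Ioo (-ρ) ρ :=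
  abs_lt.1 hz

theorem continuous_line (y : ℝ) : Continuous fun x : ℝ => (x : ℂ) + (y : ℂ) * Complex.I := by
  fun_prop

/-- `f` is bounded by `c` on the strip of half-width `ρ`. -/
def SupBound (ρ : ℝ) (f : ℂ → ℂ) (c : ℝ) : Prop :=
  ∀ z ∈ strip ρ, ‖f z‖ ≤ c

/-- `f` is analytic in the strip of half-width `ρ` and its `L²` norm along every horizontal line
of the strip is at most the real number `a`, that is, `|f|_ρ ≤ a`. -/
structure L2Bound (ρ : ℝ) (f : ℂ → ℂ) (a : ℝ) : Prop where
  nonneg : 0 ≤ a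
  diff : DifferentiableOn ℂ f (strip ρ)
  norm_le : ∀ y ∈ Set.Ioo (-ρ) ρ,
    eLpNorm (fun x : ℝ => f ((x : ℂ) + (y : ℂ) * Complex.I)) 2 volume ≤ ENNReal.ofReal a

/-- `f ∈ H^{1,ρ}`, with `|f|_ρ ≤ a` and `|f'|_ρ ≤ a`. -/
structure H1Bound (ρ : ℝ) (f : ℂ → ℂ) (a : ℝ) : Prop where
  self : L2Bound ρ f a
  derivBound : L2Bound ρ (deriv f) a

theorem eqOn_deriv {ρ : ℝ} {f g : ℂ → ℂ} (h : Set.EqOn f g (strip ρ)) :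
    Set.EqOn (deriv f) (deriv g) (strip ρ) :=
  h.deriv (isOpen_strip ρ)

theorem differentiableAt_of_mem_strip {ρ : ℝ} {f : ℂ → ℂ} (hf : DifferentiableOn ℂ f (strip ρ))
    {z : ℂ} (hz : z ∈ strip ρ) : DifferentiableAt ℂ f z :=
  hf.differentiableAt ((isOpen_strip ρ).mem_nhds hz)

theorem differentiableOn_deriv {ρ : ℝ} {f : ℂ → ℂ} (hf : DifferentiableOn ℂ f (strip ρ)) :
    DifferentiableOn ℂ (deriv f) (strip ρ) :=
  hf.deriv (isOpen_strip ρ)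

theorem hasDerivAt_line {ρ y : ℝ} {f : ℂ → ℂ} (hf : DifferentiableOn ℂ f (strip ρ))
    (hy : y ∈ Set.Ioo (-ρ) ρ) (x : ℝ) :
    HasDerivAt (fun x : ℝ => f ((x : ℂ) + (y : ℂ) * Complex.I))
      (deriv f ((x : ℂ) + (y : ℂ) * Complex.I)) x := by
  have h1 := (differentiableAt_of_mem_strip hf (line_mem_strip hy x)).hasDerivAt
  have h2 : HasDerivAt (fun x : ℂ => x + (y : ℂ) * Complex.I) 1 (x : ℂ) :=
    (hasDerivAt_id _).add_const _
  simpa using (HasDerivAt.comp (x : ℂ) h1 h2).comp_ofReal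

theorem continuous_comp_line {ρ y : ℝ} {f : ℂ → ℂ} (hf : DifferentiableOn ℂ f (strip ρ))
    (hy : y ∈ Set.Ioo (-ρ) ρ) :
    Continuous fun x : ℝ => f ((x : ℂ) + (y : ℂ) * Complex.I) :=
  hf.continuousOn.comp_continuous (continuous_line y) (line_mem_strip hy)

theorem SupBound.mono {ρ ρ' c c' : ℝ} {f : ℂ → ℂ} (h : SupBound ρ' f c') (hρ : ρ ≤ ρ')
    (hc : c' ≤ c) : SupBound ρ f c :=
  fun z hz => (h z (strip_mono hρ hz)).trans hc

theorem SupBound.mul {ρ c d : ℝ} {f g : ℂ → ℂ} (hf : SupBound ρ f c) (hg : SupBound ρ g d)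
    (hc : 0 ≤ c) : SupBound ρ (fun z => f z * g z) (c * d) := fun z hz => by
  rw [norm_mul]
  exact mul_le_mul (hf z hz) (hg z hz) (norm_nonneg _) hc

theorem SupBound.add {ρ c d : ℝ} {f g : ℂ → ℂ} (hf : SupBound ρ f c) (hg : SupBound ρ g d) :
    SupBound ρ (fun z => f z + g z) (c + d) := fun z hz =>
  (norm_add_le _ _).trans (add_le_add (hf z hz) (hg z hz))

theorem SupBound.const_mul {ρ c : ℝ} {f : ℂ → ℂ} (hf : SupBound ρ f c) (k : ℂ) :
    SupBound ρ (fun z => k * f z) (‖k‖ * c) := fun z hz => by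
  rw [norm_mul]
  exact mul_le_mul_of_nonneg_left (hf z hz) (norm_nonneg _)

theorem L2Bound.mono {ρ ρ' a a' : ℝ} {f : ℂ → ℂ} (h : L2Bound ρ' f a') (hρ : ρ ≤ ρ')
    (ha : a' ≤ a) : L2Bound ρ f a where
  nonneg := h.nonneg.trans ha
  diff := h.diff.mono (strip_mono hρ)
  norm_le := fun y hy => (h.norm_le y ⟨by linarith [hy.1], by linarith [hy.2]⟩).trans
    (ENNReal.ofReal_le_ofReal ha)

theorem L2Bound.congr {ρ a : ℝ} {f g : ℂ → ℂ} (h : L2Bound ρ f a)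
    (hfg : Set.EqOn f g (strip ρ)) : L2Bound ρ g a where
  nonneg := h.nonneg
  diff := h.diff.congr fun z hz => (hfg hz).symm
  norm_le := fun y hy => by
    have h1 : (fun x : ℝ => g ((x : ℂ) + (y : ℂ) * Complex.I)) =
        fun x : ℝ => f ((x : ℂ) + (y : ℂ) * Complex.I) :=
      funext fun x => (hfg (line_mem_strip hy x)).symm
    rw [h1]
    exact h.norm_le y hy

theorem L2Bound.memLp {ρ a y : ℝ} {f : ℂ → ℂ} (h : L2Bound ρ f a) (hy : y ∈ Set.Ioo (-ρ) ρ) :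
    MemLp (fun x : ℝ => f ((x : ℂ) + (y : ℂ) * Complex.I)) 2 volume :=
  ⟨(continuous_comp_line h.diff hy).aestronglyMeasurable,
    (h.norm_le y hy).trans_lt ENNReal.ofReal_lt_top⟩

theorem L2Bound.add {ρ a b : ℝ} {f g : ℂ → ℂ} (hf : L2Bound ρ f a) (hg : L2Bound ρ g b) :
    L2Bound ρ (fun z => f z + g z) (a + b) where
  nonneg := add_nonneg hf.nonneg hg.nonneg
  diff := hf.diff.add hg.diff
  norm_le := fun y hy => by
    rw [ENNReal.ofReal_add hf.nonneg hg.nonneg]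
    exact (eLpNorm_add_le (hf.memLp hy).1 (hg.memLp hy).1 one_le_two).trans
      (add_le_add (hf.norm_le y hy) (hg.norm_le y hy))

theorem L2Bound.const_mul {ρ a : ℝ} {f : ℂ → ℂ} (hf : L2Bound ρ f a) (k : ℂ) :
    L2Bound ρ (fun z => k * f z) (‖k‖ * a) where
  nonneg := mul_nonneg (norm_nonneg _) hf.nonneg
  diff := hf.diff.const_mul k
  norm_le := fun y hy => by
    rw [ENNReal.ofReal_mul (norm_nonneg _)]
    refine (eLpNorm_le_mul_eLpNorm_of_ae_le_mul (Eventually.of_forall fun x => ?_) 2).trans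
      (mul_le_mul_right (hf.norm_le y hy) _)
    exact (norm_mul _ _).le

theorem SupBound.mul_L2Bound {ρ a c : ℝ} {f g : ℂ → ℂ} (hf : SupBound ρ f c)
    (hfd : DifferentiableOn ℂ f (strip ρ)) (hc : 0 ≤ c) (hg : L2Bound ρ g a) :
    L2Bound ρ (fun z => f z * g z) (c * a) where
  nonneg := mul_nonneg hc hg.nonneg
  diff := hfd.mul hg.diff
  norm_le := fun y hy => by
    rw [ENNReal.ofReal_mul hc]
    refine (eLpNorm_le_mul_eLpNorm_of_ae_le_mul (Eventually.of_forall fun x => ?_) 2).trans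
      (mul_le_mul_right (hg.norm_le y hy) _)
    rw [norm_mul]
    exact mul_le_mul_of_nonneg_right (hf _ (line_mem_strip hy x)) (norm_nonneg _)

theorem H1Bound.mono {ρ ρ' a a' : ℝ} {f : ℂ → ℂ} (h : H1Bound ρ' f a') (hρ : ρ ≤ ρ')
    (ha : a' ≤ a) : H1Bound ρ f a :=
  ⟨h.self.mono hρ ha, h.derivBound.mono hρ ha⟩

theorem H1Bound.congr {ρ a : ℝ} {f g : ℂ → ℂ} (h : H1Bound ρ f a)
    (hfg : Set.EqOn f g (strip ρ)) : H1Bound ρ g a :=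
  ⟨h.self.congr hfg, h.derivBound.congr (eqOn_deriv hfg)⟩

theorem H1Bound.diff {ρ a : ℝ} {f : ℂ → ℂ} (h : H1Bound ρ f a) :
    DifferentiableOn ℂ f (strip ρ) :=
  h.self.diff

theorem H1Bound.add {ρ a b : ℝ} {f g : ℂ → ℂ} (hf : H1Bound ρ f a) (hg : H1Bound ρ g b) :
    H1Bound ρ (fun z => f z + g z) (a + b) where
  self := hf.self.add hg.self
  derivBound := (hf.derivBound.add hg.derivBound).congr fun _ hz =>
    (deriv_fun_add (differentiableAt_of_mem_strip hf.diff hz)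
      (differentiableAt_of_mem_strip hg.diff hz)).symm

theorem H1Bound.const_mul {ρ a : ℝ} {f : ℂ → ℂ} (hf : H1Bound ρ f a) (k : ℂ) :
    H1Bound ρ (fun z => k * f z) (‖k‖ * a) where
  self := hf.self.const_mul k
  derivBound := (hf.derivBound.const_mul k).congr fun _ hz =>
    (deriv_const_mul k (differentiableAt_of_mem_strip hf.diff hz)).symm

theorem MemH.h1Bound {ρ a : ℝ} {f : ℂ → ℂ} (hf : MemH 1 ρ f) (ha : 0 ≤ a)
    (h : hNorm 1 ρ f ≤ ENNReal.ofReal a) : H1Bound ρ f a := by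
  have h0 := hf 0 zero_le_one
  have h1 := hf 1 le_rfl
  simp only [iteratedDeriv_zero, iteratedDeriv_one] at h0 h1
  simp only [hNorm, Finset.sum_range_succ, Finset.sum_range_zero, iteratedDeriv_zero,
    iteratedDeriv_one, zero_add] at h
  refine ⟨⟨ha, h0.1, fun y hy => ?_⟩, ⟨ha, h1.1, fun y hy => ?_⟩⟩
  · exact (le_iSup₂ (f := fun y (_ : y ∈ Set.Ioo (-ρ) ρ) =>
      eLpNorm (fun x : ℝ => f ((x : ℂ) + (y : ℂ) * Complex.I)) 2 volume) y hy).trans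
      (le_self_add.trans h)
  · exact (le_iSup₂ (f := fun y (_ : y ∈ Set.Ioo (-ρ) ρ) =>
      eLpNorm (fun x : ℝ => deriv f ((x : ℂ) + (y : ℂ) * Complex.I)) 2 volume) y hy).trans
      (le_add_self.trans h)

theorem MemH.hNorm_lt_top {ρ : ℝ} {f : ℂ → ℂ} (hf : MemH 1 ρ f) : hNorm 1 ρ f < ∞ := by
  refine ENNReal.sum_lt_top.2 fun j hj => (hf j ?_).2.2
  have := Finset.mem_range.1 hj
  omega

theorem MemH.exists_h1Bound {ρ : ℝ} {f : ℂ → ℂ} (hf : MemH 1 ρ f) :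
    H1Bound ρ f (hNorm 1 ρ f).toReal :=
  hf.h1Bound ENNReal.toReal_nonneg (ENNReal.ofReal_toReal hf.hNorm_lt_top.ne).ge

theorem L2Bound.stripNorm_le {ρ a : ℝ} {f : ℂ → ℂ} (h : L2Bound ρ f a) :
    stripNorm ρ f ≤ ENNReal.ofReal a :=
  iSup₂_le h.norm_le

theorem L2Bound.memH0 {ρ a : ℝ} {f : ℂ → ℂ} (h : L2Bound ρ f a) : MemH0 ρ f :=
  ⟨h.diff, fun _ hy => h.memLp hy, h.stripNorm_le.trans_lt ENNReal.ofReal_lt_top⟩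

theorem H1Bound.memH {ρ a : ℝ} {f : ℂ → ℂ} (h : H1Bound ρ f a) : MemH 1 ρ f := by
  intro j hj
  interval_cases j
  · simpa using h.self.memH0
  · simpa using h.derivBound.memH0

theorem H1Bound.hNorm_le {ρ a : ℝ} {f : ℂ → ℂ} (h : H1Bound ρ f a) :
    hNorm 1 ρ f ≤ ENNReal.ofReal (2 * a) := by
  simp only [hNorm, Finset.sum_range_succ, Finset.sum_range_zero, iteratedDeriv_zero,
    iteratedDeriv_one, zero_add]
  rw [two_mul, ENNReal.ofReal_add h.self.nonneg h.self.nonneg]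
  exact add_le_add h.self.stripNorm_le h.derivBound.stripNorm_le

/-! ### Averages, Cauchy's estimate and the Sobolev inequality -/

theorem eLpNorm_two_le_iff {α : Type*} [MeasurableSpace α] {μ : Measure α} {f : α → ℂ}
    {c : ℝ≥0∞} : eLpNorm f 2 μ ≤ c ↔ ∫⁻ x, ‖f x‖ₑ ^ (2 : ℝ) ∂μ ≤ c ^ (2 : ℝ) := by
  have h := eLpNorm_nnreal_pow_eq_lintegral (μ := μ) (f := f) (p := 2) two_ne_zero
  simp only [NNReal.coe_ofNat, ENNReal.coe_ofNat] at h
  rw [← h, ENNReal.rpow_le_rpow_iff two_pos]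

/-- Minkowski's inequality for averages: a function dominated by an average (over the parameter
`s`) of functions whose `L²` norm is at most `c` has itself an `L²` norm at most `c`. -/
theorem eLpNorm_two_le_of_le_average {ν : Measure ℝ} [IsProbabilityMeasure ν] {h : ℝ → ℝ → ℂ}
    (hc : Continuous (Function.uncurry h)) {F : ℝ → ℂ} (hF : ∀ x, ‖F x‖ₑ ≤ ∫⁻ s, ‖h x s‖ₑ ∂ν)
    {c : ℝ≥0∞} (hb : ∀ s, eLpNorm (fun x => h x s) 2 volume ≤ c) :
    eLpNorm F 2 volume ≤ c := by
  have hm : Measurable (Function.uncurry fun x s => ‖h x s‖ₑ ^ (2 : ℝ)) :=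
    hc.measurable.enorm.pow_const 2
  have hx : ∀ x, Continuous (h x) := fun x => hc.comp (by fun_prop : Continuous fun s => (x, s))
  rw [eLpNorm_two_le_iff]
  calc ∫⁻ x, ‖F x‖ₑ ^ (2 : ℝ) ≤ ∫⁻ x, ∫⁻ s, ‖h x s‖ₑ ^ (2 : ℝ) ∂ν := by
        refine lintegral_mono fun x => ?_
        have h1 : ‖F x‖ₑ ≤ eLpNorm (h x) 2 ν := by
          refine (hF x).trans ?_
          rw [← eLpNorm_one_eq_lintegral_enorm]
          exact eLpNorm_le_eLpNorm_of_exponent_le one_le_two (hx x).aestronglyMeasurable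
        have h3 := eLpNorm_nnreal_pow_eq_lintegral (μ := ν) (f := h x) (p := 2) two_ne_zero
        simp only [NNReal.coe_ofNat, ENNReal.coe_ofNat] at h3
        rw [← h3]
        exact ENNReal.rpow_le_rpow h1 zero_le_two
    _ = ∫⁻ s, (∫⁻ x, ‖h x s‖ₑ ^ (2 : ℝ)) ∂ν := lintegral_lintegral_swap hm.aemeasurable
    _ ≤ ∫⁻ _, c ^ (2 : ℝ) ∂ν := by
        refine lintegral_mono fun s => ?_
        exact eLpNorm_two_le_iff.1 (hb s)
    _ = c ^ (2 : ℝ) := by simp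

theorem enorm_deriv_le_average {U : Set ℂ} (hU : IsOpen U) {f : ℂ → ℂ}
    (hf : DifferentiableOn ℂ f U) {z : ℂ} {r : ℝ} (hr : 0 < r) (hz : Metric.closedBall z r ⊆ U) :
    ‖deriv f z‖ₑ ≤ ∫⁻ θ, ‖(r : ℂ)⁻¹ * f (circleMap z r θ)‖ₑ
      ∂((ENNReal.ofReal (2 * Real.pi))⁻¹ • volume.restrict (Set.Ioc 0 (2 * Real.pi))) := by
  have hpi : 0 < 2 * Real.pi := Real.two_pi_pos
  rw [← Complex.two_pi_I_inv_smul_circleIntegral_sub_sq_inv_smul_of_differentiable hU hz hf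
    (Metric.mem_ball_self hr), lintegral_smul_measure, enorm_smul]
  have h1 : ‖(2 * (Real.pi : ℂ) * Complex.I)⁻¹‖ₑ = (ENNReal.ofReal (2 * Real.pi))⁻¹ := by
    rw [← ofReal_norm, ← ENNReal.ofReal_inv_of_pos hpi]
    simp [abs_of_pos Real.pi_pos]
  rw [h1, smul_eq_mul, circleIntegral, intervalIntegral.integral_of_le hpi.le]
  refine mul_le_mul_right ((enorm_integral_le_lintegral_enorm _).trans
    (lintegral_mono fun θ => le_of_eq ?_)) _
  rw [← ofReal_norm, ← ofReal_norm]
  congr 1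
  simp only [deriv_circleMap, norm_smul, norm_mul, norm_inv, norm_pow, circleMap_sub_center,
    norm_circleMap_zero, Complex.norm_I, Complex.norm_real, Real.norm_eq_abs, abs_of_pos hr]
  field_simp

/-- Cauchy's estimate for the norms `|·|_ρ`. -/
theorem L2Bound.cauchy {ρ ρ' δ a : ℝ} {f : ℂ → ℂ} (hf : L2Bound ρ' f a) (hδ : 0 < δ)
    (h : ρ + δ ≤ ρ') : L2Bound ρ (deriv f) (δ⁻¹ * a) where
  nonneg := mul_nonneg (inv_nonneg.2 hδ.le) hf.nonneg
  diff := (differentiableOn_deriv hf.diff).mono (strip_mono (by linarith))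
  norm_le := fun y hy => by
    have hpi : 0 < 2 * Real.pi := Real.two_pi_pos
    have hmem : ∀ x θ : ℝ, circleMap ((x : ℂ) + (y : ℂ) * Complex.I) δ θ ∈ strip ρ' :=
      fun x θ => mem_strip_of_norm_sub_le h (line_mem_strip hy x)
        (by simp [circleMap_sub_center, abs_of_pos hδ])
    have : IsProbabilityMeasure
        ((ENNReal.ofReal (2 * Real.pi))⁻¹ • volume.restrict (Set.Ioc 0 (2 * Real.pi))) := by
      constructor
      rw [Measure.smul_apply, Measure.restrict_apply_univ, Real.volume_Ioc, sub_zero, smul_eq_mul]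
      exact ENNReal.inv_mul_cancel (by simpa using hpi) ENNReal.ofReal_ne_top
    refine eLpNorm_two_le_of_le_average
      (ν := (ENNReal.ofReal (2 * Real.pi))⁻¹ • volume.restrict (Set.Ioc 0 (2 * Real.pi)))
      (h := fun x θ => (δ : ℂ)⁻¹ * f (circleMap ((x : ℂ) + (y : ℂ) * Complex.I) δ θ)) ?_ ?_ ?_
    · refine continuous_const.mul (hf.diff.continuousOn.comp_continuous ?_ fun p => hmem p.1 p.2)
      simp only [circleMap]
      fun_prop
    · intro x
      refine enorm_deriv_le_average (isOpen_strip ρ') hf.diff hδ fun w hw => ?_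
      exact mem_strip_of_norm_sub_le h (line_mem_strip hy x) (by simpa [dist_eq_norm] using hw)
    · intro θ
      -- the points `x + i y + δ e^{iθ}` run over a horizontal line as `x` varies
      have hy' : y + δ * Real.sin θ ∈ Set.Ioo (-ρ') ρ' := by
        have := im_mem_Ioo (hmem 0 θ)
        simpa [circleMap, Complex.exp_ofReal_mul_I_im] using this
      have hk := (hf.const_mul ((δ : ℂ)⁻¹)).norm_le _ hy'
      have h2 : ‖((δ : ℂ)⁻¹)‖ = δ⁻¹ := by simp [abs_of_pos hδ]
      rw [h2] at hk
      have hms : MeasurePreserving (fun x : ℝ => x + δ * Real.cos θ) volume volume :=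
        measurePreserving_add_right volume _
      rw [← eLpNorm_comp_measurePreserving
        (continuous_comp_line (hf.const_mul _).diff hy').aestronglyMeasurable hms] at hk
      refine le_of_eq_of_le ?_ hk
      congr 1
      funext x
      simp only [circleMap, Function.comp_def, Complex.exp_mul_I]
      congr 2
      push_cast
      ring

/-- Cauchy's estimate for suprema. -/
theorem SupBound.cauchy {ρ ρ' δ c : ℝ} {f : ℂ → ℂ} (hf : SupBound ρ' f c)
    (hfd : DifferentiableOn ℂ f (strip ρ')) (hδ : 0 < δ) (h : ρ + δ ≤ ρ') :
    SupBound ρ (deriv f) (c / δ) := fun z hz => by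
  have hmem : ∀ w, ‖w - z‖ ≤ δ → w ∈ strip ρ' := fun w hw => mem_strip_of_norm_sub_le h hz hw
  refine Complex.norm_deriv_le_of_forall_mem_sphere_norm_le hδ ?_ fun w hw => ?_
  · refine DifferentiableOn.diffContOnCl (hfd.mono fun w hw => hmem w ?_)
    rw [closure_ball z hδ.ne'] at hw
    simpa [dist_eq_norm] using hw
  · exact hf w (hmem w (by simpa [dist_eq_norm] using (Metric.mem_sphere.1 hw).le))

/-- The Sobolev inequality `H¹ ⊆ L^∞` on the horizontal lines of the strip. It comes from
integrating `(f²)' = 2 f f'` from `-∞`. -/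
theorem H1Bound.supBound {ρ a : ℝ} {f : ℂ → ℂ} (h : H1Bound ρ f a) : SupBound ρ f (2 * a) := by
  intro z hz
  have hy := im_mem_Ioo hz
  set φ : ℝ → ℂ := fun x => f ((x : ℂ) + (z.im : ℂ) * Complex.I) with hφ
  set ψ : ℝ → ℂ := fun x => deriv f ((x : ℂ) + (z.im : ℂ) * Complex.I) with hψ
  have hz' : f z = φ z.re := by rw [hφ]; simp only [Complex.re_add_im]
  have hφ2 : MemLp φ 2 volume := h.self.memLp hy
  have hψ2 : MemLp ψ 2 volume := h.derivBound.memLp hy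
  have hd : ∀ x, HasDerivAt (fun x => φ x * φ x) (ψ x * φ x + φ x * ψ x) x := fun x =>
    HasDerivAt.fun_mul (hasDerivAt_line h.diff hy x) (hasDerivAt_line h.diff hy x)
  have hi1 : Integrable (fun x => φ x * φ x) volume := hφ2.integrable_mul hφ2
  have hi2 : Integrable (fun x => ψ x * φ x + φ x * ψ x) volume :=
    (hψ2.integrable_mul hφ2).add (hφ2.integrable_mul hψ2)
  have ht := tendsto_zero_of_hasDerivAt_of_integrableOn_Iic (a := z.re) (fun x _ => hd x)
    hi2.integrableOn hi1.integrableOn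
  have hint := integral_Iic_of_hasDerivAt_of_tendsto (a := z.re)
    (hd z.re).continuousAt.continuousWithinAt (fun x _ => hd x) hi2.integrableOn ht
  have hsq : ∀ {g : ℝ → ℂ}, MemLp g 2 volume →
      eLpNorm g 2 volume ≤ ENNReal.ofReal a → ∫ x, ‖g x‖ ^ 2 ≤ a ^ 2 := by
    intro g hg hga
    rw [eLpNorm_two_le_iff] at hga
    rw [integral_eq_lintegral_of_nonneg_ae (Eventually.of_forall fun x => sq_nonneg ‖g x‖)
      (hg.1.norm.pow 2)]
    refine ENNReal.toReal_le_of_le_ofReal (sq_nonneg a) ?_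
    refine le_trans (le_of_eq (lintegral_congr fun x => ?_)) (hga.trans (le_of_eq ?_))
    · rw [ENNReal.ofReal_pow (norm_nonneg _), ofReal_norm]
      norm_num
    · rw [ENNReal.ofReal_pow h.self.nonneg]
      norm_num
  have hiφ : Integrable (fun x => ‖φ x‖ ^ 2) volume := hφ2.integrable_norm_pow two_ne_zero
  have hiψ : Integrable (fun x => ‖ψ x‖ ^ 2) volume := hψ2.integrable_norm_pow two_ne_zero
  have hfin : ‖φ z.re‖ ^ 2 ≤ a ^ 2 + a ^ 2 := by
    calc ‖φ z.re‖ ^ 2 = ‖φ z.re * φ z.re‖ := by rw [norm_mul, sq]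
      _ = ‖∫ x in Set.Iic z.re, (ψ x * φ x + φ x * ψ x)‖ := by rw [hint, sub_zero]
      _ ≤ ∫ x in Set.Iic z.re, (‖φ x‖ ^ 2 + ‖ψ x‖ ^ 2) := by
        refine norm_integral_le_of_norm_le (hiφ.add hiψ).integrableOn
          (Eventually.of_forall fun x => ?_)
        rw [mul_comm (ψ x), ← two_mul, norm_mul, norm_mul]
        simp only [Complex.norm_ofNat]
        nlinarith [sq_nonneg (‖φ x‖ - ‖ψ x‖)]
      _ ≤ ∫ x, (‖φ x‖ ^ 2 + ‖ψ x‖ ^ 2) :=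
        setIntegral_le_integral (hiφ.add hiψ) (Eventually.of_forall fun x => by positivity)
      _ = (∫ x, ‖φ x‖ ^ 2) + ∫ x, ‖ψ x‖ ^ 2 := integral_add hiφ hiψ
      _ ≤ a ^ 2 + a ^ 2 :=
        add_le_add (hsq hφ2 (h.self.norm_le _ hy)) (hsq hψ2 (h.derivBound.norm_le _ hy))
  rw [hz']
  exact (sq_le_sq₀ (norm_nonneg _) (by linarith [h.self.nonneg])).1 (by nlinarith [sq_nonneg a])

/-! ### The resolvents of `∂_x` and the operator `∂_x (1 - ∂_x²)⁻¹` -/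

/-- The exponential average `∫₀^∞ e^{-s} g(z + ε s) ds`. For `ε = 1` and `ε = -1` this is
`(1 - ∂_x)⁻¹ g` and `(1 + ∂_x)⁻¹ g`. -/
noncomputable def expAvg (ε : ℝ) (g : ℂ → ℂ) (z : ℂ) : ℂ :=
  ∫ s in Set.Ioi (0 : ℝ), (Real.exp (-s) : ℂ) * g (z + ((ε * s : ℝ) : ℂ))

theorem integrableOn_exp_neg : IntegrableOn (fun s : ℝ => Real.exp (-s)) (Set.Ioi 0) volume :=
  integrableOn_exp_neg_Ioi 0

theorem continuous_expAvg_integrand {ρ : ℝ} {g : ℂ → ℂ} (hg : DifferentiableOn ℂ g (strip ρ))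
    (ε : ℝ) {z : ℂ} (hz : z ∈ strip ρ) :
    Continuous fun s : ℝ => (Real.exp (-s) : ℂ) * g (z + ((ε * s : ℝ) : ℂ)) := by
  refine Continuous.mul (by fun_prop) (hg.continuousOn.comp_continuous (by fun_prop) fun s => ?_)
  exact add_real_mem_strip hz _

theorem norm_expAvg_integrand_le {ρ c : ℝ} {g : ℂ → ℂ} (hc : SupBound ρ g c) (ε : ℝ) {z : ℂ}
    (hz : z ∈ strip ρ) (s : ℝ) :
    ‖(Real.exp (-s) : ℂ) * g (z + ((ε * s : ℝ) : ℂ))‖ ≤ Real.exp (-s) * c := by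
  rw [norm_mul, Complex.norm_real, Real.norm_eq_abs, Real.abs_exp]
  exact mul_le_mul_of_nonneg_left (hc _ (add_real_mem_strip hz _)) (Real.exp_pos _).le

theorem integrableOn_expAvg {ρ c : ℝ} {g : ℂ → ℂ} (hg : DifferentiableOn ℂ g (strip ρ))
    (hc : SupBound ρ g c) (ε : ℝ) {z : ℂ} (hz : z ∈ strip ρ) :
    IntegrableOn (fun s : ℝ => (Real.exp (-s) : ℂ) * g (z + ((ε * s : ℝ) : ℂ))) (Set.Ioi 0)
      volume :=
  (integrableOn_exp_neg.mul_const c).mono'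
    (continuous_expAvg_integrand hg ε hz).aestronglyMeasurable
    (Eventually.of_forall (norm_expAvg_integrand_le hc ε hz))

theorem expAvg_congr {ρ : ℝ} {g g' : ℂ → ℂ} (h : Set.EqOn g g' (strip ρ)) (ε : ℝ) {z : ℂ}
    (hz : z ∈ strip ρ) : expAvg ε g z = expAvg ε g' z := by
  unfold expAvg
  refine integral_congr_ae (Eventually.of_forall fun s => ?_)
  simp only
  rw [h (add_real_mem_strip hz _)]

theorem expAvg_neg (ε : ℝ) (g : ℂ → ℂ) (z : ℂ) :
    expAvg ε (fun w => -g w) z = -expAvg ε g z := by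
  simp [expAvg, integral_neg]

theorem SupBound.expAvg {ρ c : ℝ} {g : ℂ → ℂ} (hc : SupBound ρ g c) (ε : ℝ) :
    SupBound ρ (expAvg ε g) c := fun z hz => by
  refine (norm_integral_le_of_norm_le (integrableOn_exp_neg.mul_const c)
    (Eventually.of_forall (norm_expAvg_integrand_le hc ε hz))).trans (le_of_eq ?_)
  rw [integral_mul_const, integral_exp_neg_Ioi_zero, one_mul]

theorem hasDerivAt_expAvg_deriv {ρ c : ℝ} {g : ℂ → ℂ} (hg : DifferentiableOn ℂ g (strip ρ))
    (hc : SupBound ρ g c) (ε : ℝ) {z : ℂ} (hz : z ∈ strip ρ) :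
    HasDerivAt (expAvg ε g) (expAvg ε (deriv g) z) z := by
  obtain ⟨ρ₁, hz₁, hρ₁⟩ := exists_between (show |z.im| < ρ from hz)
  have hg' := (differentiableOn_deriv hg).mono (strip_mono hρ₁.le)
  have hc' : SupBound ρ₁ (deriv g) (c / (ρ - ρ₁)) :=
    hc.cauchy hg (sub_pos.2 hρ₁) (by linarith)
  have hev : ∀ᶠ w in 𝓝 z, w ∈ strip ρ₁ := (isOpen_strip ρ₁).mem_nhds hz₁
  refine (hasDerivAt_integral_of_dominated_loc_of_deriv_le
    (F := fun w s => (Real.exp (-s) : ℂ) * g (w + ((ε * s : ℝ) : ℂ)))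
    (F' := fun w s => (Real.exp (-s) : ℂ) * deriv g (w + ((ε * s : ℝ) : ℂ)))
    (bound := fun s => Real.exp (-s) * (c / (ρ - ρ₁)))
    ((isOpen_strip ρ₁).mem_nhds hz₁) ?_ (integrableOn_expAvg hg hc ε hz) ?_ ?_ ?_ ?_).2
  · filter_upwards [hev] with w hw
    exact (continuous_expAvg_integrand hg ε (strip_mono hρ₁.le hw)).aestronglyMeasurable
  · exact (continuous_expAvg_integrand hg' ε hz₁).aestronglyMeasurable
  · exact Eventually.of_forall fun s w hw => norm_expAvg_integrand_le hc' ε hw s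
  · exact integrableOn_exp_neg.mul_const _
  · refine Eventually.of_forall fun s w hw => ?_
    have h1 := (differentiableAt_of_mem_strip hg
      (strip_mono hρ₁.le (add_real_mem_strip hw (ε * s)))).hasDerivAt
    simpa using (h1.comp_add_const w ((ε * s : ℝ) : ℂ)).const_mul (Real.exp (-s) : ℂ)

/-- Integration by parts: `ε A(g') = A g - g` for the average `A` of direction `ε`. -/
theorem expAvg_deriv {ρ c : ℝ} {g : ℂ → ℂ} (hg : DifferentiableOn ℂ g (strip ρ))
    (hc : SupBound ρ g c) (ε : ℝ) {z : ℂ} (hz : z ∈ strip ρ) :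
    (ε : ℂ) * expAvg ε (deriv g) z = expAvg ε g z - g z := by
  obtain ⟨ρ₁, hz₁, hρ₁⟩ := exists_between (show |z.im| < ρ from hz)
  have hg' := (differentiableOn_deriv hg).mono (strip_mono hρ₁.le)
  have hc' : SupBound ρ₁ (deriv g) (c / (ρ - ρ₁)) :=
    hc.cauchy hg (sub_pos.2 hρ₁) (by linarith)
  have hi := integrableOn_expAvg hg hc ε hz
  have hi' := integrableOn_expAvg hg' hc' ε hz₁
  have hd : ∀ s : ℝ, HasDerivAt (fun s : ℝ => (Real.exp (-s) : ℂ) * g (z + ((ε * s : ℝ) : ℂ)))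
      (ε * ((Real.exp (-s) : ℂ) * deriv g (z + ((ε * s : ℝ) : ℂ)))
        - (Real.exp (-s) : ℂ) * g (z + ((ε * s : ℝ) : ℂ))) s := by
    intro s
    have h1 := (differentiableAt_of_mem_strip hg (add_real_mem_strip hz (ε * s))).hasDerivAt
    have h2 : HasDerivAt (fun s : ℝ => z + ((ε * s : ℝ) : ℂ)) (ε : ℂ) s := by
      have := (((hasDerivAt_id s).const_mul ε).ofReal_comp).const_add z
      simpa using this
    have h3 := h1.scomp s h2
    have h4 : HasDerivAt (fun s : ℝ => (Real.exp (-s) : ℂ)) ((-Real.exp (-s) : ℝ) : ℂ) s := by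
      have := ((hasDerivAt_neg s).exp).ofReal_comp
      simpa using this
    have h5 := h4.fun_mul h3
    refine h5.congr_deriv ?_
    simp only [Function.comp_apply, smul_eq_mul, Complex.ofReal_neg]
    ring
  have ht : Tendsto (fun s : ℝ => (Real.exp (-s) : ℂ) * g (z + ((ε * s : ℝ) : ℂ))) atTop (𝓝 0) := by
    have h0 : Tendsto (fun s : ℝ => Real.exp (-s) * c) atTop (𝓝 0) := by
      simpa using Real.tendsto_exp_neg_atTop_nhds_zero.mul_const c
    exact squeeze_zero_norm (norm_expAvg_integrand_le hc ε hz) h0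
  have h := integral_Ioi_of_hasDerivAt_of_tendsto (a := (0 : ℝ))
    (hd 0).continuousAt.continuousWithinAt (fun s _ => hd s) ((hi'.const_mul (ε : ℂ)).sub hi) ht
  rw [integral_sub (hi'.const_mul (ε : ℂ)) hi, integral_const_mul] at h
  simp only [mul_zero, Complex.ofReal_zero, add_zero, neg_zero, Real.exp_zero,
    Complex.ofReal_one, one_mul, zero_sub] at h
  change (ε : ℂ) * expAvg ε (deriv g) z - expAvg ε g z = -g z at h
  linear_combination h

theorem hasDerivAt_expAvg {ρ c : ℝ} {g : ℂ → ℂ} (hg : DifferentiableOn ℂ g (strip ρ))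
    (hc : SupBound ρ g c) {ε : ℝ} (hε : ε * ε = 1) {z : ℂ} (hz : z ∈ strip ρ) :
    HasDerivAt (expAvg ε g) (ε * (expAvg ε g z - g z)) z := by
  rw [← expAvg_deriv hg hc ε hz, ← mul_assoc, ← Complex.ofReal_mul, hε, Complex.ofReal_one,
    one_mul]
  exact hasDerivAt_expAvg_deriv hg hc ε hz

theorem L2Bound.expAvg {ρ a c : ℝ} {g : ℂ → ℂ} (hg : L2Bound ρ g a) (hc : SupBound ρ g c)
    (ε : ℝ) : L2Bound ρ (expAvg ε g) a where
  nonneg := hg.nonneg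
  diff := fun _ hz =>
    (hasDerivAt_expAvg_deriv hg.diff hc ε hz).differentiableAt.differentiableWithinAt
  norm_le := fun y hy => by
    have hm : Measurable fun s : ℝ => ENNReal.ofReal (Real.exp (-s)) := by fun_prop
    have : IsProbabilityMeasure ((volume.restrict (Set.Ioi (0 : ℝ))).withDensity
        fun s => ENNReal.ofReal (Real.exp (-s))) := by
      constructor
      rw [withDensity_apply _ MeasurableSet.univ, Measure.restrict_univ,
        ← ofReal_integral_eq_lintegral_ofReal integrableOn_exp_neg
          (Eventually.of_forall fun s => (Real.exp_pos _).le), integral_exp_neg_Ioi_zero,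
        ENNReal.ofReal_one]
    refine eLpNorm_two_le_of_le_average (ν := (volume.restrict (Set.Ioi (0 : ℝ))).withDensity
        fun s => ENNReal.ofReal (Real.exp (-s)))
      (h := fun x s => g ((x : ℂ) + (y : ℂ) * Complex.I + ((ε * s : ℝ) : ℂ))) ?_ ?_ ?_
    · refine hg.diff.continuousOn.comp_continuous (by fun_prop) fun p => ?_
      exact add_real_mem_strip (line_mem_strip hy _) _
    · intro x
      rw [lintegral_withDensity_eq_lintegral_mul₀ hm.aemeasurable]
      · refine (enorm_integral_le_lintegral_enorm _).trans
          (lintegral_mono fun s => le_of_eq ?_)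
        rw [enorm_mul, Pi.mul_apply, ← ofReal_norm (Complex.ofReal _), Complex.norm_real,
          Real.norm_eq_abs, Real.abs_exp]
      · have hcont : Continuous fun s : ℝ =>
            g ((x : ℂ) + (y : ℂ) * Complex.I + ((ε * s : ℝ) : ℂ)) := by
          refine hg.diff.continuousOn.comp_continuous (by fun_prop) fun s => ?_
          exact add_real_mem_strip (line_mem_strip hy _) _
        exact hcont.measurable.enorm.aemeasurable
    · intro s
      have hms : MeasurePreserving (fun x : ℝ => x + ε * s) volume volume :=
        measurePreserving_add_right volume _
      have hk := hg.norm_le y hy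
      rw [← eLpNorm_comp_measurePreserving (hg.memLp hy).1 hms] at hk
      refine le_of_eq_of_le ?_ hk
      congr 1
      funext x
      simp only [Function.comp_def]
      congr 1
      push_cast
      ring

/-- The operator `(1 - ∂_x²)⁻¹`, half the sum of the two resolvents of `∂_x` at `±1`. -/
noncomputable def helmInv (g : ℂ → ℂ) (z : ℂ) : ℂ :=
  (1 / 2 : ℂ) * (expAvg 1 g z + expAvg (-1) g z)

/-- The operator `∂_x (1 - ∂_x²)⁻¹`. -/
noncomputable def dHelmInv (g : ℂ → ℂ) (z : ℂ) : ℂ :=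
  (1 / 2 : ℂ) * (expAvg 1 g z + -1 * expAvg (-1) g z)

theorem hasDerivAt_helmInv {ρ c : ℝ} {g : ℂ → ℂ} (hg : DifferentiableOn ℂ g (strip ρ))
    (hc : SupBound ρ g c) {z : ℂ} (hz : z ∈ strip ρ) :
    HasDerivAt (helmInv g) (dHelmInv g z) z := by
  refine (((hasDerivAt_expAvg hg hc (ε := 1) (by norm_num) hz).add
    (hasDerivAt_expAvg hg hc (ε := -1) (by norm_num) hz)).const_mul (1 / 2 : ℂ)).congr_deriv ?_
  simp only [dHelmInv]
  push_cast
  ring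

/-- `∂_x² (1 - ∂_x²)⁻¹ = (1 - ∂_x²)⁻¹ - 1`, an operator of order zero. -/
theorem hasDerivAt_dHelmInv {ρ c : ℝ} {g : ℂ → ℂ} (hg : DifferentiableOn ℂ g (strip ρ))
    (hc : SupBound ρ g c) {z : ℂ} (hz : z ∈ strip ρ) :
    HasDerivAt (dHelmInv g) (helmInv g z - g z) z := by
  refine (((hasDerivAt_expAvg hg hc (ε := 1) (by norm_num) hz).add
    ((hasDerivAt_expAvg hg hc (ε := -1) (by norm_num) hz).const_mul (-1))).const_mul
      (1 / 2 : ℂ)).congr_deriv ?_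
  simp only [helmInv]
  push_cast
  ring

theorem norm_half : ‖(1 / 2 : ℂ)‖ = 1 / 2 := by norm_num

theorem L2Bound.helmInv {ρ a c : ℝ} {g : ℂ → ℂ} (hg : L2Bound ρ g a) (hc : SupBound ρ g c) :
    L2Bound ρ (helmInv g) a :=
  (((hg.expAvg hc 1).add (hg.expAvg hc (-1))).const_mul (1 / 2)).mono le_rfl
    (by rw [norm_half]; linarith)

theorem L2Bound.dHelmInv {ρ a c : ℝ} {g : ℂ → ℂ} (hg : L2Bound ρ g a) (hc : SupBound ρ g c) :
    L2Bound ρ (dHelmInv g) a :=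
  (((hg.expAvg hc 1).add ((hg.expAvg hc (-1)).const_mul (-1))).const_mul (1 / 2)).mono le_rfl
    (by rw [norm_half, norm_neg, norm_one]; linarith)

theorem SupBound.dHelmInv {ρ c : ℝ} {g : ℂ → ℂ} (hc : SupBound ρ g c) :
    SupBound ρ (dHelmInv g) c :=
  (((hc.expAvg 1).add ((hc.expAvg (-1)).const_mul (-1))).const_mul (1 / 2)).mono le_rfl
    (by rw [norm_half, norm_neg, norm_one]; linarith)

/-- A bounded analytic solution of `k - k'' = 0` in a strip vanishes: the resolvent identities
give first `k = k'` and then `k = 0`. -/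
theorem eq_zero_of_bounded_of_deriv_deriv_eq {ρ c : ℝ} {k : ℂ → ℂ}
    (hk : DifferentiableOn ℂ k (strip ρ)) (hc : SupBound ρ k c)
    (h : ∀ z ∈ strip ρ, deriv (deriv k) z = k z) : ∀ z ∈ strip ρ, k z = 0 := by
  have hk' := differentiableOn_deriv hk
  have h1 : Set.EqOn (deriv k) k (strip ρ) := by
    intro z hz
    obtain ⟨ρ₁, hz₁, hρ₁⟩ := exists_between (show |z.im| < ρ from hz)
    have hs := strip_mono hρ₁.le
    have hb : SupBound ρ₁ (fun w => k w + -1 * deriv k w) (c + ‖(-1 : ℂ)‖ * (c / (ρ - ρ₁))) :=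
      (hc.mono hρ₁.le le_rfl).add
        ((hc.cauchy hk (sub_pos.2 hρ₁) (by linarith)).const_mul (-1))
    have hd : DifferentiableOn ℂ (fun w => k w + -1 * deriv k w) (strip ρ₁) :=
      (hk.add (hk'.const_mul (-1))).mono hs
    have hder : Set.EqOn (deriv fun w => k w + -1 * deriv k w)
        (fun w => -(k w + -1 * deriv k w)) (strip ρ₁) := by
      intro w hw
      have e1 := (differentiableAt_of_mem_strip hk (hs hw)).hasDerivAt
      have e2 := (differentiableAt_of_mem_strip hk' (hs hw)).hasDerivAt
      rw [(e1.fun_add (e2.const_mul (-1))).deriv, h w (hs hw)]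
      ring
    have e := expAvg_deriv hd hb (-1) hz₁
    rw [expAvg_congr hder (-1) hz₁, expAvg_neg] at e
    push_cast at e
    linear_combination -e
  intro z hz
  have e := expAvg_deriv hk hc 1 hz
  rw [expAvg_congr h1 1 hz] at e
  push_cast at e
  linear_combination e

/-- The bounded solution of `h - h'' = -G'` is `h = -∂_x (1 - ∂_x²)⁻¹ G`. -/
theorem eq_neg_dHelmInv {ρ c d : ℝ} {h G : ℂ → ℂ} (hh : DifferentiableOn ℂ h (strip ρ))
    (hc : SupBound ρ h c) (hG : DifferentiableOn ℂ G (strip ρ)) (hd : SupBound ρ G d)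
    (heq : ∀ z ∈ strip ρ, h z - deriv (deriv h) z = -deriv G z) :
    ∀ z ∈ strip ρ, h z = -dHelmInv G z := by
  have hQ : DifferentiableOn ℂ (dHelmInv G) (strip ρ) := fun z hz =>
    (hasDerivAt_dHelmInv hG hd hz).differentiableAt.differentiableWithinAt
  have key := eq_zero_of_bounded_of_deriv_deriv_eq (k := fun z => h z + dHelmInv G z)
    (hh.add hQ) (hc.add hd.dHelmInv) ?_
  · intro z hz
    linear_combination key z hz
  · have h1 : Set.EqOn (deriv fun z => h z + dHelmInv G z)
        (fun z => deriv h z + (helmInv G z - G z)) (strip ρ) := fun z hz =>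
      ((differentiableAt_of_mem_strip hh hz).hasDerivAt.fun_add
        (hasDerivAt_dHelmInv hG hd hz)).deriv
    intro z hz
    rw [eqOn_deriv h1 hz, ((differentiableAt_of_mem_strip (differentiableOn_deriv hh)
      hz).hasDerivAt.fun_add ((hasDerivAt_helmInv hG hd hz).fun_sub
        (differentiableAt_of_mem_strip hG hz).hasDerivAt)).deriv]
    linear_combination -heq z hz

/-! ### The nonlocal form of the equation -/

/-- The polarized flux `(b/2) u v + ((3-b)/2) u_x v_x`. -/
noncomputable def flux (b : ℝ) (u v : ℂ → ℂ) (z : ℂ) : ℂ :=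
  ((b / 2 : ℝ) : ℂ) * (u z * v z) + (((3 - b) / 2 : ℝ) : ℂ) * (deriv u z * deriv v z)

/-- The bilinear form whose diagonal is the right-hand side of the nonlocal form
`u_t = -u u_x - ∂_x (1 - ∂_x²)⁻¹ ((b/2) u² + ((3-b)/2) u_x²)` of the `b`-family equation. -/
noncomputable def nonlocalForm (b : ℝ) (u v : ℂ → ℂ) (z : ℂ) : ℂ :=
  -1 * (u z * deriv v z + dHelmInv (flux b u v) z)

theorem differentiableOn_flux {ρ : ℝ} (b : ℝ) {u v : ℂ → ℂ} (hu : DifferentiableOn ℂ u (strip ρ))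
    (hv : DifferentiableOn ℂ v (strip ρ)) : DifferentiableOn ℂ (flux b u v) (strip ρ) :=
  ((hu.mul hv).const_mul _).add
    (((differentiableOn_deriv hu).mul (differentiableOn_deriv hv)).const_mul _)

theorem deriv_flux {ρ : ℝ} (b : ℝ) {u v : ℂ → ℂ} (hu : DifferentiableOn ℂ u (strip ρ))
    (hv : DifferentiableOn ℂ v (strip ρ)) {z : ℂ} (hz : z ∈ strip ρ) :
    deriv (flux b u v) z = ((b / 2 : ℝ) : ℂ) * (deriv u z * v z + u z * deriv v z) +
      (((3 - b) / 2 : ℝ) : ℂ) *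
        (deriv (deriv u) z * deriv v z + deriv u z * deriv (deriv v) z) := by
  have du := (differentiableAt_of_mem_strip hu hz).hasDerivAt
  have dv := (differentiableAt_of_mem_strip hv hz).hasDerivAt
  have du' := (differentiableAt_of_mem_strip (differentiableOn_deriv hu) hz).hasDerivAt
  have dv' := (differentiableAt_of_mem_strip (differentiableOn_deriv hv) hz).hasDerivAt
  exact (((du.fun_mul dv).const_mul _).fun_add ((du'.fun_mul dv').const_mul _)).deriv

theorem deriv_mul_deriv {ρ : ℝ} {u v : ℂ → ℂ} (hu : DifferentiableOn ℂ u (strip ρ))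
    (hv : DifferentiableOn ℂ v (strip ρ)) {z : ℂ} (hz : z ∈ strip ρ) :
    deriv (fun w => u w * deriv v w) z = deriv u z * deriv v z + u z * deriv (deriv v) z :=
  deriv_fun_mul (differentiableAt_of_mem_strip hu hz)
    (differentiableAt_of_mem_strip (differentiableOn_deriv hv) hz)

theorem deriv_deriv_mul_deriv {ρ : ℝ} {u v : ℂ → ℂ} (hu : DifferentiableOn ℂ u (strip ρ))
    (hv : DifferentiableOn ℂ v (strip ρ)) {z : ℂ} (hz : z ∈ strip ρ) :
    deriv (deriv fun w => u w * deriv v w) z = deriv (deriv u) z * deriv v z +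
      2 * (deriv u z * deriv (deriv v) z) + u z * deriv (deriv (deriv v)) z := by
  have h1 : Set.EqOn (deriv fun w => u w * deriv v w)
      (fun w => deriv u w * deriv v w + u w * deriv (deriv v) w) (strip ρ) :=
    fun w hw => deriv_mul_deriv hu hv hw
  have hu' := differentiableOn_deriv hu
  have hv' := differentiableOn_deriv hv
  have hv'' := differentiableOn_deriv hv'
  have du := (differentiableAt_of_mem_strip hu hz).hasDerivAt
  have du' := (differentiableAt_of_mem_strip hu' hz).hasDerivAt
  have dv' := (differentiableAt_of_mem_strip hv' hz).hasDerivAt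
  have dv'' := (differentiableAt_of_mem_strip hv'' hz).hasDerivAt
  rw [eqOn_deriv h1 hz, ((du'.fun_mul dv').fun_add (du.fun_mul dv'')).deriv]
  ring

theorem norm_ofReal_half (x : ℝ) : ‖((x / 2 : ℝ) : ℂ)‖ = |x| / 2 := by
  rw [Complex.norm_real, Real.norm_eq_abs, abs_div, abs_two]

theorem SupBound.flux {ρ c d c' d' : ℝ} (b : ℝ) {u v : ℂ → ℂ} (hu : SupBound ρ u c)
    (hv : SupBound ρ v d) (hu' : SupBound ρ (deriv u) c') (hv' : SupBound ρ (deriv v) d')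
    (hc : 0 ≤ c) (hc' : 0 ≤ c') :
    SupBound ρ (flux b u v) (|b| / 2 * (c * d) + |3 - b| / 2 * (c' * d')) := by
  have h := ((hu.mul hv hc).const_mul ((b / 2 : ℝ) : ℂ)).add
    ((hu'.mul hv' hc').const_mul (((3 - b) / 2 : ℝ) : ℂ))
  rwa [norm_ofReal_half, norm_ofReal_half] at h

/-- A function of `H^{1,ρ'}` has its derivative in `H^{1,ρ}` for `ρ < ρ'`. -/
theorem H1Bound.cauchy {ρ ρ' δ a : ℝ} {f : ℂ → ℂ} (hf : H1Bound ρ' f a) (hδ : 0 < δ)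
    (h : ρ + δ ≤ ρ') : H1Bound ρ (deriv f) (a * (1 + δ⁻¹)) where
  self := hf.derivBound.mono (by linarith) (by
    have := mul_nonneg hf.self.nonneg (inv_nonneg.2 hδ.le)
    linarith)
  derivBound := (hf.derivBound.cauchy hδ h).mono le_rfl (by
    have := hf.self.nonneg
    linarith)

/-- The growth constant of the nonlocal form. -/
noncomputable def formConst (b : ℝ) : ℝ := 4 + 2 * (|b| + |3 - b|)

theorem formConst_pos (b : ℝ) : 0 < formConst b := by
  unfold formConst
  positivity

/-- The nonlocal form loses one derivative only: it maps `H^{1,ρ+δ} × H^{1,ρ+δ}` to `H^{1,ρ}` with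
norm `O(1 + 1/δ)`. The potentially worse term `u_x v_x` is estimated as a product of a bounded
and a square integrable function, and `∂_x (1 - ∂_x²)⁻¹` maps `L²` to `H¹`. -/
theorem H1Bound.nonlocalForm {ρ ρ' δ a c : ℝ} (b : ℝ) {u v : ℂ → ℂ} (hu : H1Bound ρ' u a)
    (hv : H1Bound ρ' v c) (hδ : 0 < δ) (h : ρ + δ ≤ ρ') :
    H1Bound ρ (nonlocalForm b u v) (formConst b * (1 + δ⁻¹) * (a * c)) := by
  have ha := hu.self.nonneg
  have hc := hv.self.nonneg
  have hle : ρ ≤ ρ' := by linarith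
  have hδ' : 0 < δ⁻¹ := inv_pos.2 hδ
  have hac : 0 ≤ a * c := mul_nonneg ha hc
  have hacδ : 0 ≤ a * c * δ⁻¹ := mul_nonneg hac hδ'.le
  have u0 := hu.mono hle le_rfl
  have v0 := hv.mono hle le_rfl
  have u1 := hu.cauchy hδ h
  have v1 := hv.cauchy hδ h
  have haD := u1.self.nonneg
  have hG : L2Bound ρ (flux b u v) ((|b| + |3 - b|) * ((1 + δ⁻¹) * (a * c))) := by
    have h1 := ((u0.supBound.mul_L2Bound u0.diff (by linarith) v0.self).const_mul
      ((b / 2 : ℝ) : ℂ)).add ((u1.supBound.mul_L2Bound u1.diff (by linarith)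
        v0.derivBound).const_mul (((3 - b) / 2 : ℝ) : ℂ))
    rw [norm_ofReal_half, norm_ofReal_half] at h1
    refine h1.mono le_rfl ?_
    have := mul_nonneg (abs_nonneg b) hacδ
    linarith
  have hGs : SupBound ρ (flux b u v) _ :=
    SupBound.flux b u0.supBound v0.supBound u1.supBound v1.supBound (by linarith) (by linarith)
  have hder : Set.EqOn (deriv (dHelmInv (flux b u v)))
      (fun z => helmInv (flux b u v) z + -1 * flux b u v z) (strip ρ) := fun z hz => by
    rw [(hasDerivAt_dHelmInv hG.diff hGs hz).deriv]
    ring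
  have hQ : H1Bound ρ (dHelmInv (flux b u v))
      (2 * ((|b| + |3 - b|) * ((1 + δ⁻¹) * (a * c)))) := by
    refine ⟨(hG.dHelmInv hGs).mono le_rfl (by linarith [hG.nonneg]), ?_⟩
    refine L2Bound.congr ?_ hder.symm
    refine ((hG.helmInv hGs).add (hG.const_mul (-1))).mono le_rfl ?_
    rw [norm_neg, norm_one]
    linarith
  have hT : H1Bound ρ (fun z => u z * deriv v z) (4 * ((1 + δ⁻¹) * (a * c))) := by
    refine ⟨(u0.supBound.mul_L2Bound u0.diff (by linarith) v0.derivBound).mono le_rfl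
      (by linarith), ?_⟩
    refine L2Bound.congr ?_ fun z hz => (deriv_mul_deriv u0.diff v0.diff hz).symm
    refine ((u1.supBound.mul_L2Bound u1.diff (by linarith) v0.derivBound).add
      (u0.supBound.mul_L2Bound u0.diff (by linarith) v1.derivBound)).mono le_rfl ?_
    linarith
  refine ((hT.add hQ).const_mul (-1)).mono le_rfl ?_
  rw [norm_neg, norm_one, formConst]
  linarith

/-- Applying `1 - ∂_x²` to the nonlocal form gives a local expression. -/
theorem nonlocalForm_sub_deriv_deriv {ρ ρ' a c : ℝ} (b : ℝ) {u v : ℂ → ℂ} (hu : H1Bound ρ' u a)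
    (hv : H1Bound ρ' v c) (h : ρ < ρ') {z : ℂ} (hz : z ∈ strip ρ) :
    nonlocalForm b u v z - deriv (deriv (nonlocalForm b u v)) z =
      -(u z * deriv v z) + (deriv (deriv u) z * deriv v z + 2 * (deriv u z * deriv (deriv v) z) +
        u z * deriv (deriv (deriv v)) z)
      - ((b / 2 : ℝ) : ℂ) * (deriv u z * v z + u z * deriv v z)
      - (((3 - b) / 2 : ℝ) : ℂ) *
        (deriv (deriv u) z * deriv v z + deriv u z * deriv (deriv v) z) := by
  have hδ : 0 < ρ' - ρ := sub_pos.2 h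
  have hle : ρ + (ρ' - ρ) ≤ ρ' := by linarith
  have u0 := hu.mono h.le le_rfl
  have v0 := hv.mono h.le le_rfl
  have u1 := hu.cauchy hδ hle
  have v1 := hv.cauchy hδ hle
  have hG := differentiableOn_flux b u0.diff v0.diff
  have hGs : SupBound ρ (flux b u v) _ :=
    SupBound.flux b u0.supBound v0.supBound u1.supBound v1.supBound
      (by linarith [u0.self.nonneg]) (by linarith [u1.self.nonneg])
  have huv : DifferentiableOn ℂ (fun w => u w * deriv v w) (strip ρ) := u0.diff.mul v1.diff
  have h1 : Set.EqOn (deriv (nonlocalForm b u v)) (fun w => -1 *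
      (deriv (fun w => u w * deriv v w) w + (helmInv (flux b u v) w - flux b u v w)))
      (strip ρ) := fun w hw =>
    (((differentiableAt_of_mem_strip huv hw).hasDerivAt.fun_add
      (hasDerivAt_dHelmInv hG hGs hw)).const_mul (-1)).deriv
  have h2 := (differentiableAt_of_mem_strip (differentiableOn_deriv huv) hz).hasDerivAt
  rw [eqOn_deriv h1 hz, ((h2.fun_add ((hasDerivAt_helmInv hG hGs hz).fun_sub
    (differentiableAt_of_mem_strip hG hz).hasDerivAt)).const_mul (-1)).deriv,
    deriv_deriv_mul_deriv u0.diff v0.diff hz, deriv_flux b u0.diff v0.diff hz, nonlocalForm]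
  ring

/-- The local equation implies the nonlocal one: if `p` (in the role of `u_t`) and `u` are bounded,
with bounded `u_x`, and satisfy the `b`-family equation in a strip, then `p` is the nonlocal
form of `u`. -/
theorem eq_nonlocalForm {ρ c c' d b : ℝ} {u p : ℂ → ℂ} (hu : DifferentiableOn ℂ u (strip ρ))
    (hp : DifferentiableOn ℂ p (strip ρ)) (huc : SupBound ρ u c)
    (huc' : SupBound ρ (deriv u) c') (hc : 0 ≤ c) (hc' : 0 ≤ c') (hpd : SupBound ρ p d)
    (heq : ∀ z ∈ strip ρ, p z - iteratedDeriv 2 p z + ((b : ℂ) + 1) * u z * deriv u z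
      = (b : ℂ) * deriv u z * iteratedDeriv 2 u z + u z * iteratedDeriv 3 u z) :
    ∀ z ∈ strip ρ, p z = nonlocalForm b u u z := by
  have huu : DifferentiableOn ℂ (fun w => u w * deriv u w) (strip ρ) :=
    hu.mul (differentiableOn_deriv hu)
  intro z hz
  have key := eq_neg_dHelmInv (h := fun z => p z + u z * deriv u z) (G := flux b u u)
    (hp.add huu) (hpd.add (huc.mul huc' hc)) (differentiableOn_flux b hu hu)
    (SupBound.flux b huc huc huc' huc' hc hc') ?_ z hz
  · rw [nonlocalForm]
    linear_combination key
  · intro w hw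
    have h1 : Set.EqOn (deriv fun z => p z + u z * deriv u z)
        (fun z => deriv p z + deriv (fun z => u z * deriv u z) z) (strip ρ) := fun w hw =>
      deriv_fun_add (differentiableAt_of_mem_strip hp hw) (differentiableAt_of_mem_strip huu hw)
    have e := heq w hw
    simp only [iteratedDeriv_succ, iteratedDeriv_zero] at e
    rw [eqOn_deriv h1 hw, deriv_fun_add
      (differentiableAt_of_mem_strip (differentiableOn_deriv hp) hw)
      (differentiableAt_of_mem_strip (differentiableOn_deriv huu) hw),
      deriv_deriv_mul_deriv hu hu hw, deriv_flux b hu hu hw]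
    push_cast
    linear_combination e

/-! ### Sums and series in `H^{1,ρ}` -/

theorem L2Bound.zero (ρ : ℝ) : L2Bound ρ (fun _ => 0) 0 where
  nonneg := le_rfl
  diff := differentiableOn_const 0
  norm_le := fun y _ => by simp

theorem L2Bound.sum {ι : Type*} {ρ : ℝ} {f : ι → ℂ → ℂ} {a : ι → ℝ} (s : Finset ι)
    (h : ∀ i ∈ s, L2Bound ρ (f i) (a i)) :
    L2Bound ρ (fun z => ∑ i ∈ s, f i z) (∑ i ∈ s, a i) := by
  classical
  induction s using Finset.induction_on with
  | empty => simpa using L2Bound.zero ρ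
  | insert i s hi ih =>
    simp only [Finset.sum_insert hi]
    exact (h i (Finset.mem_insert_self i s)).add
      (ih fun j hj => h j (Finset.mem_insert_of_mem hj))

theorem deriv_sum_of_mem_strip {ι : Type*} {ρ : ℝ} {f : ι → ℂ → ℂ} (s : Finset ι)
    (h : ∀ i ∈ s, DifferentiableOn ℂ (f i) (strip ρ)) {z : ℂ} (hz : z ∈ strip ρ) :
    deriv (fun z => ∑ i ∈ s, f i z) z = ∑ i ∈ s, deriv (f i) z :=
  deriv_fun_sum fun i hi => differentiableAt_of_mem_strip (h i hi) hz

theorem H1Bound.sum {ι : Type*} {ρ : ℝ} {f : ι → ℂ → ℂ} {a : ι → ℝ} (s : Finset ι)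
    (h : ∀ i ∈ s, H1Bound ρ (f i) (a i)) :
    H1Bound ρ (fun z => ∑ i ∈ s, f i z) (∑ i ∈ s, a i) where
  self := L2Bound.sum s fun i hi => (h i hi).self
  derivBound := (L2Bound.sum s fun i hi => (h i hi).derivBound).congr fun _ hz =>
    (deriv_sum_of_mem_strip s (fun i hi => (h i hi).diff) hz).symm

/-- Completeness of the `L²` scale in the form needed here; the bound passes to the limit by
Fatou's lemma on each line. -/
theorem L2Bound.of_hasSum {ρ : ℝ} {f : ℕ → ℂ → ℂ} {a : ℕ → ℝ} {F : ℂ → ℂ}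
    (h : ∀ n, L2Bound ρ (f n) (a n)) (ha : Summable a) (hF : DifferentiableOn ℂ F (strip ρ))
    (hs : ∀ z ∈ strip ρ, HasSum (fun n => f n z) (F z)) : L2Bound ρ F (∑' n, a n) where
  nonneg := tsum_nonneg fun n => (h n).nonneg
  diff := hF
  norm_le := fun y hy => by
    have hp : ∀ N, L2Bound ρ (fun z => ∑ n ∈ Finset.range N, f n z) (∑' n, a n) := fun N =>
      (L2Bound.sum (Finset.range N) fun n _ => h n).mono le_rfl
        (ha.sum_le_tsum _ fun n _ => (h n).nonneg)
    refine (Lp.eLpNorm_lim_le_liminf_eLpNorm (fun N => ((hp N).memLp hy).1) _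
      (Eventually.of_forall fun x => (hs _ (line_mem_strip hy x)).tendsto_sum_nat)).trans ?_
    exact liminf_le_of_frequently_le' (Frequently.of_forall fun N => (hp N).norm_le y hy)

theorem H1Bound.tsum {ρ : ℝ} {f : ℕ → ℂ → ℂ} {a : ℕ → ℝ} (h : ∀ n, H1Bound ρ (f n) (a n))
    (ha : Summable a) : H1Bound ρ (fun z => ∑' n, f n z) (∑' n, a n) := by
  have hd : DifferentiableOn ℂ (fun z => ∑' n, f n z) (strip ρ) :=
    Complex.differentiableOn_tsum_of_summable_norm (ha.mul_left 2) (fun n => (h n).diff)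
      (isOpen_strip ρ) fun n => (h n).supBound
  refine ⟨L2Bound.of_hasSum (fun n => (h n).self) ha hd fun z hz => ?_,
    L2Bound.of_hasSum (fun n => (h n).derivBound) ha (differentiableOn_deriv hd) fun z hz =>
      Complex.hasSum_deriv_of_summable_norm (ha.mul_left 2) (fun n => (h n).diff)
      (isOpen_strip ρ) (fun n => (h n).supBound) hz⟩
  exact (Summable.of_norm_bounded (ha.mul_left 2) fun n => (h n).supBound z hz).hasSum

theorem hasSum_iteratedDeriv {ρ : ℝ} {f : ℕ → ℂ → ℂ} {a : ℕ → ℝ}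
    (hf : ∀ n, DifferentiableOn ℂ (f n) (strip ρ)) (hb : ∀ n, SupBound ρ (f n) (a n))
    (ha : Summable a) (j : ℕ) {z : ℂ} (hz : z ∈ strip ρ) :
    HasSum (fun n => iteratedDeriv j (f n) z) (iteratedDeriv j (fun w => ∑' n, f n w) z) := by
  induction j generalizing ρ f a with
  | zero =>
    simp only [iteratedDeriv_zero]
    exact (Summable.of_norm_bounded ha fun n => hb n z hz).hasSum
  | succ j ih =>
    obtain ⟨ρ₁, hz₁, hρ₁⟩ := exists_between (show |z.im| < ρ from hz)
    have h1 := ih (ρ := ρ₁) (f := fun n => deriv (f n)) (a := fun n => a n / (ρ - ρ₁))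
      (fun n => (differentiableOn_deriv (hf n)).mono (strip_mono hρ₁.le))
      (fun n => (hb n).cauchy (hf n) (sub_pos.2 hρ₁) (by linarith)) (ha.div_const _) hz₁
    simp only [iteratedDeriv_succ']
    have h2 : deriv (fun w => ∑' n, f n w) =ᶠ[𝓝 z] fun w => ∑' n, deriv (f n) w := by
      filter_upwards [(isOpen_strip ρ).mem_nhds hz] with w hw
      exact (Complex.hasSum_deriv_of_summable_norm ha hf (isOpen_strip ρ) hb hw).tsum_eq.symm
    rw [h2.iteratedDeriv_eq j]
    exact h1

theorem hasSum_cauchyProduct {f g : ℕ → ℂ} {F G : ℂ} (hf : HasSum f F) (hg : HasSum g G) :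
    HasSum (fun n => ∑ k ∈ Finset.range (n + 1), f k * g (n - k)) (F * G) := by
  have hf' := hf.summable.norm
  have hg' := hg.summable.norm
  rw [← hf.tsum_eq, ← hg.tsum_eq, tsum_mul_tsum_eq_tsum_sum_range_of_summable_norm hf' hg']
  exact (summable_norm_sum_mul_range_of_summable_norm hf' hg').of_norm.hasSum

/-- The superposition `∑ₙ eₙ cₙ` of the functions `cₙ` with real weights `eₙ`. -/
noncomputable def superpose (c : ℕ → ℂ → ℂ) (e : ℕ → ℝ) (z : ℂ) : ℂ :=
  ∑' n, (e n : ℂ) * c n z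

theorem H1Bound.superpose {ρ : ℝ} {c : ℕ → ℂ → ℂ} {a e : ℕ → ℝ}
    (h : ∀ n, H1Bound ρ (c n) (a n)) (hs : Summable fun n => |e n| * a n) :
    H1Bound ρ (superpose c e) (∑' n, |e n| * a n) := by
  refine H1Bound.tsum (fun n => ?_) hs
  simpa using (h n).const_mul (e n : ℂ)

theorem hasSum_iteratedDeriv_superpose {ρ : ℝ} {c : ℕ → ℂ → ℂ} {a e : ℕ → ℝ}
    (h : ∀ n, H1Bound ρ (c n) (a n)) (hs : Summable fun n => |e n| * a n) (j : ℕ) {z : ℂ}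
    (hz : z ∈ strip ρ) :
    HasSum (fun n => (e n : ℂ) * iteratedDeriv j (c n) z)
      (iteratedDeriv j (BFamily.superpose c e) z) := by
  have hb : ∀ n, H1Bound ρ (fun z => (e n : ℂ) * c n z) (|e n| * a n) := fun n => by
    simpa using (h n).const_mul (e n : ℂ)
  have := hasSum_iteratedDeriv (fun n => (hb n).diff) (fun n => (hb n).supBound)
    (hs.mul_left 2) j hz
  simp only [iteratedDeriv_const_mul_field] at this
  exact this

theorem hasSum_superpose {ρ : ℝ} {c : ℕ → ℂ → ℂ} {a e : ℕ → ℝ}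
    (h : ∀ n, H1Bound ρ (c n) (a n)) (hs : Summable fun n => |e n| * a n) {z : ℂ}
    (hz : z ∈ strip ρ) : HasSum (fun n => (e n : ℂ) * c n z) (superpose c e z) := by
  simpa using hasSum_iteratedDeriv_superpose h hs 0 hz

/-- Dominated convergence for superpositions in the norm of `H^{1,ρ}`. -/
theorem tendsto_hNorm_of_eqOn_superpose {ρ : ℝ} {c : ℕ → ℂ → ℂ} {a B : ℕ → ℝ}
    (h : ∀ n, H1Bound ρ (c n) (a n)) {l : Filter ℝ} {e : ℝ → ℕ → ℝ}
    (hB : ∀ᶠ s in l, ∀ n, |e s n| ≤ B n) (hs : Summable fun n => B n * a n)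
    (ht : ∀ n, Tendsto (fun s => e s n) l (𝓝 0)) {g : ℝ → ℂ → ℂ}
    (hg : ∀ᶠ s in l, Set.EqOn (superpose c (e s)) (g s) (strip ρ)) :
    Tendsto (fun s => hNorm 1 ρ (g s)) l (𝓝 0) := by
  have hlim : Tendsto (fun s => ∑' n, |e s n| * a n) l (𝓝 (∑' _ : ℕ, (0 : ℝ))) := by
    refine tendsto_tsum_of_dominated_convergence hs (fun n => ?_) ?_
    · simpa using (ht n).abs.mul_const (a n)
    · filter_upwards [hB] with s hBs n
      rw [norm_mul, Real.norm_eq_abs, Real.norm_eq_abs, abs_abs, abs_of_nonneg (h n).self.nonneg]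
      exact mul_le_mul_of_nonneg_right (hBs n) (h n).self.nonneg
  rw [tsum_zero] at hlim
  have hlim' : Tendsto (fun s => ENNReal.ofReal (2 * ∑' n, |e s n| * a n)) l (𝓝 0) := by
    simpa using ENNReal.tendsto_ofReal (hlim.const_mul 2)
  refine tendsto_of_tendsto_of_tendsto_of_le_of_le' tendsto_const_nhds hlim'
    (Eventually.of_forall fun _ => bot_le) ?_
  filter_upwards [hB, hg] with s hBs hgs
  refine ((H1Bound.superpose h ?_).congr hgs).hNorm_le
  exact Summable.of_nonneg_of_le (fun n => mul_nonneg (abs_nonneg _) (h n).self.nonneg)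
    (fun n => mul_le_mul_of_nonneg_right (hBs n) (h n).self.nonneg) hs

/-! ### Power series in time -/

theorem summable_nat_mul_pow_pred {r : ℝ} (h0 : 0 ≤ r) (h1 : r < 1) :
    Summable fun n : ℕ => (n : ℝ) * r ^ (n - 1) := by
  rw [← summable_nat_add_iff 1]
  have hr : ‖r‖ < 1 := by rwa [Real.norm_eq_abs, abs_of_nonneg h0]
  have := ((hasSum_coe_mul_geometric_of_norm_lt_one hr).summable).add
    (summable_geometric_of_lt_one h0 h1)
  refine this.congr fun n => ?_
  simp only [Nat.add_sub_cancel]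
  push_cast
  ring

/-- If `‖cₙ‖_{1,ρ} = O(κⁿ)` and `κ T < 1`, then `t ↦ ∑ tⁿ cₙ` is of class `C¹` on `[0,T]` with
values in `H^{1,ρ}`. -/
theorem isC1InTime_superpose_pow {ρ T κ M : ℝ} {c : ℕ → ℂ → ℂ} (hT : 0 ≤ T) (hκ : 0 ≤ κ)
    (hTκ : T * κ < 1) (h : ∀ n, H1Bound ρ (c n) (M * κ ^ n)) :
    IsC1InTime 1 ρ T (fun t => superpose c fun n => t ^ n)
      (fun t => superpose c fun n => n * t ^ (n - 1)) := by
  have hTκ0 : 0 ≤ T * κ := mul_nonneg hT hκ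
  have hM : 0 ≤ M := by simpa using (h 0).self.nonneg
  have hS0 : Summable fun n : ℕ => T ^ n * (M * κ ^ n) := by
    refine ((summable_geometric_of_lt_one hTκ0 hTκ).mul_left M).congr fun n => ?_
    rw [mul_pow]
    ring
  have hS1 : Summable fun n : ℕ => (n * T ^ (n - 1)) * (M * κ ^ n) := by
    refine ((summable_nat_mul_pow_pred hTκ0 hTκ).mul_left (M * κ)).congr fun n => ?_
    rcases n with _ | n
    · simp
    · rw [Nat.add_sub_cancel, mul_pow, pow_succ κ]
      ring
  have hS2 : Summable fun n : ℕ => (2 * (n * T ^ (n - 1))) * (M * κ ^ n) :=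
    (hS1.mul_left 2).congr fun n => by ring
  have hb0 : ∀ t ∈ Set.Icc 0 T, ∀ n : ℕ, |t ^ n| ≤ T ^ n := fun t ht n => by
    rw [abs_of_nonneg (pow_nonneg ht.1 n)]
    exact pow_le_pow_left₀ ht.1 ht.2 n
  have hb1 : ∀ t ∈ Set.Icc 0 T, ∀ n : ℕ, |(n : ℝ) * t ^ (n - 1)| ≤ n * T ^ (n - 1) := by
    intro t ht n
    rw [abs_mul, Nat.abs_cast]
    exact mul_le_mul_of_nonneg_left (hb0 t ht _) (Nat.cast_nonneg n)
  have hsum : ∀ {e B : ℕ → ℝ}, (∀ n, |e n| ≤ B n) → Summable (fun n => B n * (M * κ ^ n)) →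
      Summable fun n => |e n| * (M * κ ^ n) := fun {e B} heB hB =>
    Summable.of_nonneg_of_le (fun n => mul_nonneg (abs_nonneg _) (h n).self.nonneg)
      (fun n => mul_le_mul_of_nonneg_right (heB n) (h n).self.nonneg) hB
  refine ⟨fun t ht => (H1Bound.superpose h (hsum (hb0 t ht) hS0)).memH,
    fun t ht => (H1Bound.superpose h (hsum (hb1 t ht) hS1)).memH, fun t ht => ?_, fun t ht => ?_⟩
  · have hmem : ∀ᶠ s in 𝓝[Set.Icc 0 T \ {t}] t, s ∈ Set.Icc 0 T \ {t} := self_mem_nhdsWithin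
    refine tendsto_hNorm_of_eqOn_superpose h
      (e := fun s n => (s ^ n - t ^ n) / (s - t) - n * t ^ (n - 1)) ?_ hS2 (fun n => ?_) ?_
    · filter_upwards [hmem] with s hs n
      have hst : s - t ≠ 0 := sub_ne_zero.2 hs.2
      have h1 : |(s ^ n - t ^ n) / (s - t)| ≤ n * T ^ (n - 1) := by
        rw [abs_div, div_le_iff₀ (abs_pos.2 hst)]
        refine (abs_pow_sub_pow_le s t n).trans ?_
        have hmax : max |s| |t| ≤ T := by
          rw [abs_of_nonneg hs.1.1, abs_of_nonneg ht.1]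
          exact max_le hs.1.2 ht.2
        have := pow_le_pow_left₀ (le_max_of_le_left (abs_nonneg s)) hmax (n - 1)
        calc |s - t| * n * max |s| |t| ^ (n - 1) ≤ |s - t| * n * T ^ (n - 1) :=
              mul_le_mul_of_nonneg_left this (by positivity)
          _ = n * T ^ (n - 1) * |s - t| := by ring
      have h2 := abs_sub ((s ^ n - t ^ n) / (s - t)) (n * t ^ (n - 1))
      linarith [hb1 t ht n]
    · have h1 := hasDerivAt_iff_tendsto_slope.1 (hasDerivAt_pow n t)
      have h2 := (h1.mono_left (nhdsWithin_mono t fun s hs => hs.2 :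
        𝓝[Set.Icc 0 T \ {t}] t ≤ 𝓝[≠] t)).sub_const ((n : ℝ) * t ^ (n - 1))
      rw [sub_self] at h2
      refine h2.congr fun s => ?_
      rw [slope_def_field]
    · filter_upwards [hmem] with s hs z hz
      have hst : ((s - t : ℝ) : ℂ) ≠ 0 := Complex.ofReal_ne_zero.2 (sub_ne_zero.2 hs.2)
      have e1 := hasSum_superpose h (hsum (hb0 s hs.1) hS0) hz
      have e2 := hasSum_superpose h (hsum (hb0 t ht) hS0) hz
      have e3 := hasSum_superpose h (hsum (hb1 t ht) hS1) hz
      refine HasSum.tsum_eq ((((e1.sub e2).div_const ((s - t : ℝ) : ℂ)).sub e3).congr_fun ?_)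
      intro n
      push_cast
      ring
  · have hmem : ∀ᶠ s in 𝓝[Set.Icc 0 T] t, s ∈ Set.Icc 0 T := self_mem_nhdsWithin
    refine tendsto_hNorm_of_eqOn_superpose h
      (e := fun s n => n * s ^ (n - 1) - n * t ^ (n - 1)) ?_ hS2 (fun n => ?_) ?_
    · filter_upwards [hmem] with s hs n
      have h2 := abs_sub ((n : ℝ) * s ^ (n - 1)) (n * t ^ (n - 1))
      linarith [hb1 t ht n, hb1 s hs n]
    · have hc : Continuous fun s : ℝ => (n : ℝ) * s ^ (n - 1) - n * t ^ (n - 1) := by fun_prop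
      have := (hc.tendsto t).mono_left (nhdsWithin_le_nhds (s := Set.Icc 0 T))
      simpa using this
    · filter_upwards [hmem] with s hs z hz
      have e1 := hasSum_superpose h (hsum (hb1 s hs) hS1) hz
      have e3 := hasSum_superpose h (hsum (hb1 t ht) hS1) hz
      refine HasSum.tsum_eq ((e1.sub e3).congr_fun ?_)
      intro n
      push_cast
      ring

/-! ### The Taylor coefficients of the solution -/

/-- The Taylor coefficients in time of the formal solution `∑ tⁿ cₙ` of the nonlocal equation with
initial datum `u₀`: `(n + 1) cₙ₊₁` is the sum over `k ≤ n` of the nonlocal form at `(cₖ, cₙ₋ₖ)`. -/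
noncomputable def taylorCoeff (b : ℝ) (u₀ : ℂ → ℂ) : ℕ → ℂ → ℂ
  | 0 => u₀
  | n + 1 => fun z => ((n + 1 : ℝ)⁻¹ : ℂ) *
      ∑ k : Fin (n + 1), nonlocalForm b (taylorCoeff b u₀ k) (taylorCoeff b u₀ (n - k)) z

theorem taylorCoeff_succ (b : ℝ) (u₀ : ℂ → ℂ) (n : ℕ) :
    taylorCoeff b u₀ (n + 1) = fun z => ((n + 1 : ℝ)⁻¹ : ℂ) *
      ∑ k ∈ Finset.range (n + 1),
        nonlocalForm b (taylorCoeff b u₀ k) (taylorCoeff b u₀ (n - k)) z := by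
  rw [taylorCoeff]
  funext z
  rw [Fin.sum_univ_eq_sum_range
    (fun k => nonlocalForm b (taylorCoeff b u₀ k) (taylorCoeff b u₀ (n - k)) z) (n + 1)]

theorem catalan_succ_eq_sum_range (n : ℕ) :
    catalan (n + 1) = ∑ k ∈ Finset.range (n + 1), catalan k * catalan (n - k) := by
  rw [catalan_succ, Fin.sum_univ_eq_sum_range (fun k => catalan k * catalan (n - k)) (n + 1)]

theorem catalan_le_four_pow (n : ℕ) : catalan n ≤ 4 ^ n := by
  rw [catalan_eq_centralBinom_div]
  exact (Nat.div_le_self _ _).trans (Nat.centralBinom_le_four_pow n)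

theorem add_two_div_pow_le (n : ℕ) : (((n : ℝ) + 2) / (n + 1)) ^ n ≤ 3 := by
  have hn : (0 : ℝ) < n + 1 := by positivity
  have h1 : ((n : ℝ) + 2) / (n + 1) ≤ Real.exp (1 / (n + 1)) := by
    have := Real.add_one_le_exp (1 / ((n : ℝ) + 1))
    refine le_trans (le_of_eq ?_) this
    field_simp
    ring
  calc (((n : ℝ) + 2) / (n + 1)) ^ n ≤ Real.exp (1 / (n + 1)) ^ n :=
        pow_le_pow_left₀ (by positivity) h1 n
    _ = Real.exp (n * (1 / (n + 1))) := (Real.exp_nat_mul _ n).symm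
    _ ≤ Real.exp 1 := by
        refine Real.exp_le_exp.2 ?_
        rw [mul_one_div, div_le_one hn]
        linarith
    _ ≤ 3 := Real.exp_one_lt_three.le

/-- The constant `L` in the majorant `(L / (ρ₀ - ρ))ⁿ` of the Taylor coefficients. -/
noncomputable def growthConst (b ρ₀ M : ℝ) : ℝ := 6 * formConst b * (ρ₀ + 1) * M

/-- The Cauchy–Kovalevskaya majorant. Each step costs a factor `O(1 / δ)`; sharing the distance
`ρ₀ - ρ` in `n + 2` equal parts and giving up only one of them, `δ = (ρ₀ - ρ) / (n + 2)`, the factor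
`n + 2` is absorbed by the denominator `n + 1` of the recursion. The Catalan numbers solve the
remaining quadratic recursion. -/
theorem h1Bound_taylorCoeff {b ρ₀ M : ℝ} {u₀ : ℂ → ℂ} (hρ₀ : 0 < ρ₀) (hu₀ : H1Bound ρ₀ u₀ M)
    (n : ℕ) : ∀ ρ : ℝ, 0 < ρ → ρ < ρ₀ → H1Bound ρ (taylorCoeff b u₀ n)
      (M * catalan n * (growthConst b ρ₀ M / (ρ₀ - ρ)) ^ n) := by
  have hM := hu₀.self.nonneg
  have hK := formConst_pos b
  have hL : 0 ≤ growthConst b ρ₀ M := by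
    unfold growthConst
    positivity
  induction n using Nat.strong_induction_on with
  | _ n ih =>
  intro ρ hρ hρρ₀
  rcases n with _ | n
  · rw [taylorCoeff]
    exact hu₀.mono hρρ₀.le (by simp)
  have hd : 0 < ρ₀ - ρ := sub_pos.2 hρρ₀
  have hn1 : (0 : ℝ) < (n : ℝ) + 1 := by positivity
  have hn2 : (0 : ℝ) < (n : ℝ) + 2 := by positivity
  obtain ⟨δ, hδ⟩ : ∃ δ, δ = (ρ₀ - ρ) / (n + 2) := ⟨_, rfl⟩
  have hδ0 : 0 < δ := hδ ▸ div_pos hd hn2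
  have hδ' : ρ₀ - (ρ + δ) = (ρ₀ - ρ) * ((n + 1) / (n + 2)) := by
    rw [hδ]
    field_simp
    ring
  have hρ' : ρ + δ < ρ₀ := by
    have : 0 < ρ₀ - (ρ + δ) := hδ' ▸ by positivity
    linarith
  set p := growthConst b ρ₀ M / (ρ₀ - ρ) with hp
  have hp0 : 0 ≤ p := div_nonneg hL hd.le
  set q := growthConst b ρ₀ M / (ρ₀ - (ρ + δ)) with hq
  have hqp : q = p * ((n + 2) / (n + 1)) := by
    rw [hq, hp, hδ']
    field_simp
  have hsum : H1Bound ρ (taylorCoeff b u₀ (n + 1)) (‖((n + 1 : ℝ)⁻¹ : ℂ)‖ *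
      ∑ k ∈ Finset.range (n + 1), formConst b * (1 + δ⁻¹) *
        (M * catalan k * q ^ k * (M * catalan (n - k) * q ^ (n - k)))) := by
    rw [taylorCoeff_succ]
    refine (H1Bound.sum _ fun k hk => ?_).const_mul _
    have hk' := Finset.mem_range.1 hk
    exact (ih k hk' (ρ + δ) (by linarith) hρ').nonlocalForm b
      (ih (n - k) (by omega) (ρ + δ) (by linarith) hρ') hδ0 le_rfl
  refine hsum.mono le_rfl ?_
  have hnorm : ‖((n + 1 : ℝ)⁻¹ : ℂ)‖ = ((n : ℝ) + 1)⁻¹ := by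
    have h0 : (((n + 1 : ℝ) : ℂ))⁻¹ = (((n + 1 : ℝ)⁻¹ : ℝ) : ℂ) := by push_cast; rfl
    rw [h0, Complex.norm_real, Real.norm_eq_abs, abs_of_pos (inv_pos.2 hn1)]
  have hcat : ∑ k ∈ Finset.range (n + 1), formConst b * (1 + δ⁻¹) *
      (M * catalan k * q ^ k * (M * catalan (n - k) * q ^ (n - k))) =
      formConst b * (1 + δ⁻¹) * M ^ 2 * q ^ n * catalan (n + 1) := by
    rw [catalan_succ_eq_sum_range]
    push_cast
    rw [Finset.mul_sum]
    refine Finset.sum_congr rfl fun k hk => ?_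
    have hk' := Finset.mem_range.1 hk
    have : q ^ n = q ^ k * q ^ (n - k) := by rw [← pow_add]; congr 1; omega
    rw [this]
    ring
  rw [hnorm, hcat, hqp, mul_pow]
  have hD : 1 + δ⁻¹ ≤ (ρ₀ + 1) * (n + 2) / (ρ₀ - ρ) := by
    rw [hδ, inv_div, le_div_iff₀ hd, add_mul, one_mul, div_mul_cancel₀ _ hd.ne']
    nlinarith [mul_nonneg hρ₀.le (Nat.cast_nonneg (α := ℝ) n)]
  have hr : ((n : ℝ) + 1)⁻¹ * (n + 2) ≤ 2 := by
    rw [inv_mul_le_iff₀ hn1]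
    linarith [Nat.cast_nonneg (α := ℝ) n]
  have h3 := add_two_div_pow_le n
  have hC : (0 : ℝ) ≤ catalan (n + 1) := Nat.cast_nonneg _
  calc ((n : ℝ) + 1)⁻¹ * (formConst b * (1 + δ⁻¹) * M ^ 2 *
        (p ^ n * (((n : ℝ) + 2) / (n + 1)) ^ n) * catalan (n + 1))
      ≤ ((n : ℝ) + 1)⁻¹ * (formConst b * ((ρ₀ + 1) * (n + 2) / (ρ₀ - ρ)) * M ^ 2 *
        (p ^ n * 3) * catalan (n + 1)) := by gcongr
    _ = (((n : ℝ) + 1)⁻¹ * (n + 2)) * (formConst b * ((ρ₀ + 1) / (ρ₀ - ρ)) * M ^ 2 *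
        (p ^ n * 3) * catalan (n + 1)) := by ring
    _ ≤ 2 * (formConst b * ((ρ₀ + 1) / (ρ₀ - ρ)) * M ^ 2 * (p ^ n * 3) * catalan (n + 1)) := by
        refine mul_le_mul_of_nonneg_right hr ?_
        positivity
    _ = M * catalan (n + 1) * p ^ (n + 1) := by
        rw [pow_succ, hp, growthConst]
        ring

theorem h1Bound_taylorCoeff_geometric {b ρ₀ ρ M : ℝ} {u₀ : ℂ → ℂ} (hρ₀ : 0 < ρ₀)
    (hu₀ : H1Bound ρ₀ u₀ M) (hρ : 0 < ρ) (hρρ₀ : ρ < ρ₀) (n : ℕ) :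
    H1Bound ρ (taylorCoeff b u₀ n) (M * (4 * (growthConst b ρ₀ M / (ρ₀ - ρ))) ^ n) := by
  have hM := hu₀.self.nonneg
  have hK := formConst_pos b
  have hL : 0 ≤ growthConst b ρ₀ M / (ρ₀ - ρ) := by
    refine div_nonneg ?_ (sub_pos.2 hρρ₀).le
    unfold growthConst
    positivity
  refine (h1Bound_taylorCoeff hρ₀ hu₀ n ρ hρ hρρ₀).mono le_rfl ?_
  rw [mul_pow, mul_assoc]
  refine mul_le_mul_of_nonneg_left (mul_le_mul_of_nonneg_right ?_ (pow_nonneg hL n)) hM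
  exact_mod_cast catalan_le_four_pow n

/-- The recursion for the coefficients in local form, after applying `1 - ∂_x²`. -/
theorem taylorCoeff_succ_sub_deriv_deriv {b ρ ρ' : ℝ} {u₀ : ℂ → ℂ} {a : ℕ → ℝ}
    (h : ∀ n, H1Bound ρ' (taylorCoeff b u₀ n) (a n)) (hρ : ρ < ρ') (n : ℕ) {z : ℂ}
    (hz : z ∈ strip ρ) :
    ((n : ℂ) + 1) * (taylorCoeff b u₀ (n + 1) z - deriv (deriv (taylorCoeff b u₀ (n + 1))) z) =
      ∑ k ∈ Finset.range (n + 1),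
        (nonlocalForm b (taylorCoeff b u₀ k) (taylorCoeff b u₀ (n - k)) z -
          deriv (deriv (nonlocalForm b (taylorCoeff b u₀ k) (taylorCoeff b u₀ (n - k)))) z) := by
  have hd : ∀ k, DifferentiableOn ℂ
      (nonlocalForm b (taylorCoeff b u₀ k) (taylorCoeff b u₀ (n - k))) (strip ρ) := fun k =>
    ((h k).nonlocalForm b (h (n - k)) (sub_pos.2 hρ) (by linarith : ρ + (ρ' - ρ) ≤ ρ')).diff
  have hn : (n : ℂ) + 1 ≠ 0 := Nat.cast_add_one_ne_zero n
  have h1 : Set.EqOn (deriv (taylorCoeff b u₀ (n + 1))) (fun z => ((n + 1 : ℝ)⁻¹ : ℂ) *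
      ∑ k ∈ Finset.range (n + 1),
        deriv (nonlocalForm b (taylorCoeff b u₀ k) (taylorCoeff b u₀ (n - k))) z) (strip ρ) := by
    intro w hw
    rw [taylorCoeff_succ, deriv_const_mul, deriv_sum_of_mem_strip _ (fun k _ => hd k) hw]
    exact DifferentiableAt.fun_sum fun k _ => differentiableAt_of_mem_strip (hd k) hw
  rw [eqOn_deriv h1 hz, deriv_const_mul, deriv_sum_of_mem_strip _
    (fun k _ => differentiableOn_deriv (hd k)) hz, taylorCoeff_succ, ← mul_sub,
    ← Finset.sum_sub_distrib]
  · push_cast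
    rw [← mul_assoc, mul_inv_cancel₀ hn, one_mul]
  · exact DifferentiableAt.fun_sum fun k _ =>
      differentiableAt_of_mem_strip (differentiableOn_deriv (hd k)) hz

/-- The sum of the Taylor series solves the `b`-family equation: all the terms are Cauchy products
of power series in `t`. -/
theorem solvesBFamily_superpose_taylorCoeff {b ρ ρ' T κ M : ℝ} {u₀ : ℂ → ℂ} (hκ : 0 ≤ κ)
    (hTκ : T * κ < 1) (hρ : ρ < ρ') (h : ∀ n, H1Bound ρ' (taylorCoeff b u₀ n) (M * κ ^ n)) :
    SolvesBFamily b ρ T (fun t => superpose (taylorCoeff b u₀) fun n => t ^ n)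
      (fun t => superpose (taylorCoeff b u₀) fun n => n * t ^ (n - 1)) := by
  intro t ht z hz
  have hz' := strip_mono hρ.le hz
  set c := taylorCoeff b u₀ with hc
  have htκ0 : 0 ≤ t * κ := mul_nonneg ht.1 hκ
  have htκ : t * κ < 1 := (mul_le_mul_of_nonneg_right ht.2 hκ).trans_lt hTκ
  have hS0 : Summable fun n : ℕ => |t ^ n| * (M * κ ^ n) := by
    refine ((summable_geometric_of_lt_one htκ0 htκ).mul_left M).congr fun n => ?_
    rw [mul_pow, abs_of_nonneg (pow_nonneg ht.1 n)]
    ring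
  have hS1 : Summable fun n : ℕ => |(n : ℝ) * t ^ (n - 1)| * (M * κ ^ n) := by
    refine ((summable_nat_mul_pow_pred htκ0 htκ).mul_left (M * κ)).congr fun n => ?_
    rw [abs_of_nonneg (mul_nonneg (Nat.cast_nonneg n) (pow_nonneg ht.1 _))]
    rcases n with _ | n
    · simp
    · rw [Nat.add_sub_cancel, mul_pow, pow_succ κ]
      ring
  set U : ℕ → ℕ → ℂ := fun j n => ((t ^ n : ℝ) : ℂ) * iteratedDeriv j (c n) z with hU
  have hSU : ∀ j, HasSum (U j) (iteratedDeriv j (superpose c fun n => t ^ n) z) := fun j =>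
    hasSum_iteratedDeriv_superpose h hS0 j hz'
  have hV : HasSum (fun n : ℕ => ((((n + 1 : ℕ) : ℝ) * t ^ n : ℝ) : ℂ) *
      (iteratedDeriv 0 (c (n + 1)) z - iteratedDeriv 2 (c (n + 1)) z))
      (iteratedDeriv 0 (superpose c fun n => n * t ^ (n - 1)) z -
        iteratedDeriv 2 (superpose c fun n => n * t ^ (n - 1)) z) := by
    have h1 := (hasSum_iteratedDeriv_superpose h hS1 0 hz').sub
      (hasSum_iteratedDeriv_superpose h hS1 2 hz')
    rw [← hasSum_nat_add_iff' 1] at h1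
    simp only [Finset.range_one, Finset.sum_singleton, Nat.cast_zero, zero_mul,
      Complex.ofReal_zero, sub_zero, Nat.add_sub_cancel] at h1
    exact h1.congr_fun fun n => (mul_sub _ _ _)
  have hP : ∀ i j, HasSum (fun n => ∑ k ∈ Finset.range (n + 1), U i k * U j (n - k))
      (iteratedDeriv i (superpose c fun n => t ^ n) z *
        iteratedDeriv j (superpose c fun n => t ^ n) z) := fun i j =>
    hasSum_cauchyProduct (hSU i) (hSU j)
  have hR := ((((hP 0 1).neg.add (((hP 2 1).add ((hP 1 2).mul_left 2)).add (hP 0 3))).sub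
    (((hP 1 0).add (hP 0 1)).mul_left ((b / 2 : ℝ) : ℂ))).sub
    (((hP 2 1).add (hP 1 2)).mul_left (((3 - b) / 2 : ℝ) : ℂ)))
  have heq : ∀ n : ℕ, ((((n + 1 : ℕ) : ℝ) * t ^ n : ℝ) : ℂ) *
      (iteratedDeriv 0 (c (n + 1)) z - iteratedDeriv 2 (c (n + 1)) z) =
      -(∑ k ∈ Finset.range (n + 1), U 0 k * U 1 (n - k)) +
      (∑ k ∈ Finset.range (n + 1), U 2 k * U 1 (n - k) +
        2 * ∑ k ∈ Finset.range (n + 1), U 1 k * U 2 (n - k) +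
        ∑ k ∈ Finset.range (n + 1), U 0 k * U 3 (n - k)) -
      ((b / 2 : ℝ) : ℂ) * (∑ k ∈ Finset.range (n + 1), U 1 k * U 0 (n - k) +
        ∑ k ∈ Finset.range (n + 1), U 0 k * U 1 (n - k)) -
      (((3 - b) / 2 : ℝ) : ℂ) * (∑ k ∈ Finset.range (n + 1), U 2 k * U 1 (n - k) +
        ∑ k ∈ Finset.range (n + 1), U 1 k * U 2 (n - k)) := by
    intro n
    have e := taylorCoeff_succ_sub_deriv_deriv h hρ n hz
    have e2 : ((((n + 1 : ℕ) : ℝ) * t ^ n : ℝ) : ℂ) *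
        (iteratedDeriv 0 (c (n + 1)) z - iteratedDeriv 2 (c (n + 1)) z) =
        ((t ^ n : ℝ) : ℂ) * (((n : ℂ) + 1) * (c (n + 1) z - deriv (deriv (c (n + 1))) z)) := by
      simp only [iteratedDeriv_succ, iteratedDeriv_zero]
      push_cast
      ring
    rw [e2, e]
    simp only [Finset.mul_sum, ← Finset.sum_neg_distrib, ← Finset.sum_add_distrib,
      ← Finset.sum_sub_distrib]
    refine Finset.sum_congr rfl fun k hk => ?_
    have hk' := Finset.mem_range.1 hk
    have ht' : ((t ^ n : ℝ) : ℂ) = ((t ^ k : ℝ) : ℂ) * ((t ^ (n - k) : ℝ) : ℂ) := by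
      rw [← Complex.ofReal_mul, ← pow_add]
      congr 2
      omega
    rw [nonlocalForm_sub_deriv_deriv b (h k) (h (n - k)) hρ hz, ht']
    simp only [hU, iteratedDeriv_succ, iteratedDeriv_zero]
    ring
  have key := (hV.congr_fun fun n => (heq n).symm).unique hR
  simp only [iteratedDeriv_zero, iteratedDeriv_one] at key
  push_cast at key
  linear_combination key

/-- Existence for the Cauchy problem, on a time interval where the series is dominated by a
geometric series of ratio `1/2`. -/
theorem exists_isSolution {b ρ₀ M : ℝ} {u₀ : ℂ → ℂ} (hρ₀ : 0 < ρ₀) (hM : 0 < M)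
    (hu₀ : H1Bound ρ₀ u₀ M) {ρ : ℝ} (hρ : 0 < ρ) (hρρ₀ : ρ < ρ₀) :
    ∃ u, IsSolution b ρ ((ρ₀ - ρ) / (16 * growthConst b ρ₀ M)) u₀ u := by
  have hL : 0 < growthConst b ρ₀ M := by
    have := formConst_pos b
    unfold growthConst
    positivity
  have hd : 0 < ρ₀ - ρ := sub_pos.2 hρρ₀
  -- the equation is checked in a slightly larger strip, the midpoint of `ρ` and `ρ₀`
  set ρ' := (ρ + ρ₀) / 2 with hρ'
  set κ := 4 * (growthConst b ρ₀ M / (ρ₀ - ρ')) with hκ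
  have hd' : ρ₀ - ρ' = (ρ₀ - ρ) / 2 := by rw [hρ']; ring
  have hκ0 : 0 ≤ κ := by
    rw [hκ, hd']
    positivity
  set T := (ρ₀ - ρ) / (16 * growthConst b ρ₀ M) with hT
  have hT0 : 0 ≤ T := by positivity
  have hTκ : T * κ < 1 := by
    have : T * κ = 1 / 2 := by
      rw [hT, hκ, hd']
      field_simp
      norm_num
    rw [this]
    norm_num
  have hc : ∀ n, H1Bound ρ' (taylorCoeff b u₀ n) (M * κ ^ n) :=
    h1Bound_taylorCoeff_geometric hρ₀ hu₀ (by linarith) (by linarith)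
  refine ⟨_, _, isC1InTime_superpose_pow hT0 hκ0 hTκ fun n => (hc n).mono (by linarith) le_rfl,
    solvesBFamily_superpose_taylorCoeff hκ0 hTκ (by linarith) hc, fun z _ => ?_⟩
  simp only [superpose]
  rw [tsum_eq_single 0]
  · simp [taylorCoeff]
  · intro n hn
    simp [hn]

/-! ### Uniqueness -/

theorem MemH.norm_le {ρ : ℝ} {f : ℂ → ℂ} (hf : MemH 1 ρ f) {z : ℂ} (hz : z ∈ strip ρ) :
    ‖f z‖ ≤ 2 * (hNorm 1 ρ f).toReal :=
  hf.exists_h1Bound.supBound z hz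

theorem IsC1InTime.memH_quotient {ρ T : ℝ} {u ut : ℝ → ℂ → ℂ} (h : IsC1InTime 1 ρ T u ut)
    {s t : ℝ} (hs : s ∈ Set.Icc 0 T) (ht : t ∈ Set.Icc 0 T) :
    MemH 1 ρ fun z => (u s z - u t z) / ((s - t : ℝ) : ℂ) - ut t z := by
  have h1 := (((h.mem s hs).exists_h1Bound.add
    ((h.mem t ht).exists_h1Bound.const_mul (-1))).const_mul (((s - t : ℝ) : ℂ)⁻¹)).add
      ((h.mem_deriv t ht).exists_h1Bound.const_mul (-1))
  refine (h1.congr fun z _ => ?_).memH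
  rw [div_eq_mul_inv]
  ring

/-- Differentiability in the norm of `H^{1,ρ}` implies pointwise differentiability. -/
theorem IsC1InTime.hasDerivWithinAt {ρ T : ℝ} {u ut : ℝ → ℂ → ℂ} (h : IsC1InTime 1 ρ T u ut)
    {t : ℝ} (ht : t ∈ Set.Icc 0 T) {z : ℂ} (hz : z ∈ strip ρ) :
    HasDerivWithinAt (fun s => u s z) (ut t z) (Set.Icc 0 T) t := by
  rw [hasDerivWithinAt_iff_tendsto_slope, tendsto_iff_norm_sub_tendsto_zero]
  have h0 := ((ENNReal.tendsto_toReal ENNReal.zero_ne_top).comp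
    (h.tendsto_quotient t ht)).const_mul 2
  rw [ENNReal.toReal_zero, mul_zero] at h0
  refine squeeze_zero' (Eventually.of_forall fun _ => norm_nonneg _) ?_ h0
  filter_upwards [self_mem_nhdsWithin] with s hs
  refine le_of_eq_of_le ?_ ((h.memH_quotient hs.1 ht).norm_le hz)
  rw [slope_def_module, Complex.real_smul, Complex.ofReal_inv, inv_mul_eq_div]

theorem IsC1InTime.exists_supBound {ρ T : ℝ} {u ut : ℝ → ℂ → ℂ} (h : IsC1InTime 1 ρ T u ut)
    {t : ℝ} (ht : t ∈ Set.Icc 0 T) :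
    ∃ η > 0, ∃ K, 0 ≤ K ∧ ∀ s ∈ Set.Icc 0 T, |s - t| < η → SupBound ρ (u s) K := by
  have hev := (h.tendsto_quotient t ht).eventually_le_const (zero_lt_one (α := ℝ≥0∞))
  obtain ⟨η, hη, hη'⟩ := Metric.mem_nhdsWithin_iff.1 hev
  have a0 : (0 : ℝ) ≤ (hNorm 1 ρ (u t)).toReal := ENNReal.toReal_nonneg
  have a1 : (0 : ℝ) ≤ (hNorm 1 ρ (ut t)).toReal := ENNReal.toReal_nonneg
  refine ⟨η, hη, η * (2 + 2 * (hNorm 1 ρ (ut t)).toReal) + 2 * (hNorm 1 ρ (u t)).toReal,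
    by positivity, fun s hs hst z hz => ?_⟩
  have h0 := (h.mem t ht).norm_le hz
  rcases eq_or_ne s t with rfl | hne
  · have : 0 ≤ η * (2 + 2 * (hNorm 1 ρ (ut s)).toReal) := by positivity
    linarith
  have h1 := (h.mem_deriv t ht).norm_le hz
  have hk : hNorm 1 ρ (fun z => (u s z - u t z) / ((s - t : ℝ) : ℂ) - ut t z) ≤ 1 :=
    hη' ⟨by simpa [Real.dist_eq] using hst, hs, hne⟩
  have h2 := (h.memH_quotient hs ht).norm_le hz
  have h3 : (hNorm 1 ρ (fun z => (u s z - u t z) / ((s - t : ℝ) : ℂ) - ut t z)).toReal ≤ 1 := by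
    simpa using ENNReal.toReal_mono ENNReal.one_ne_top hk
  have hst0 : ((s - t : ℝ) : ℂ) ≠ 0 := Complex.ofReal_ne_zero.2 (sub_ne_zero.2 hne)
  have h4 : u s z = ((s - t : ℝ) : ℂ) *
      (((u s z - u t z) / ((s - t : ℝ) : ℂ) - ut t z) + ut t z) + u t z := by
    field_simp
    ring
  have h5 : ‖((u s z - u t z) / ((s - t : ℝ) : ℂ) - ut t z) + ut t z‖ ≤
      2 + 2 * (hNorm 1 ρ (ut t)).toReal :=
    (norm_add_le _ _).trans (by linarith)
  rw [h4]
  refine (norm_add_le _ _).trans (add_le_add ?_ h0)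
  rw [norm_mul, Complex.norm_real, Real.norm_eq_abs]
  exact mul_le_mul hst.le h5 (norm_nonneg _) hη.le

theorem dHelmInv_sub {ρ c d : ℝ} {f g : ℂ → ℂ} (hf : DifferentiableOn ℂ f (strip ρ))
    (hg : DifferentiableOn ℂ g (strip ρ)) (hfc : SupBound ρ f c) (hgd : SupBound ρ g d) {z : ℂ}
    (hz : z ∈ strip ρ) :
    dHelmInv (fun w => f w - g w) z = dHelmInv f z - dHelmInv g z := by
  have h : ∀ ε, expAvg ε (fun w => f w - g w) z = expAvg ε f z - expAvg ε g z := fun ε => by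
    simp only [expAvg, mul_sub]
    exact integral_sub (integrableOn_expAvg hf hfc ε hz) (integrableOn_expAvg hg hgd ε hz)
  simp only [dHelmInv, h]
  ring

/-- A Lipschitz estimate with loss of one derivative, in sup norms on strips, for the nonlocal
form. -/
theorem supBound_nonlocalForm_sub {b R σ δ K K' E : ℝ} {u w : ℂ → ℂ}
    (hu : DifferentiableOn ℂ u (strip R)) (hw : DifferentiableOn ℂ w (strip R))
    (huK : SupBound R u K) (hwK : SupBound R w K) (huK' : SupBound R (deriv u) K')
    (hwK' : SupBound R (deriv w) K') (hK : 0 ≤ K) (hK' : 0 ≤ K') (hδ : 0 < δ) (hδR : δ ≤ R)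
    (hσ : σ + δ ≤ R) (hE : 0 ≤ E) (hv : SupBound (σ + δ) (fun z => u z - w z) E) :
    SupBound σ (fun z => nonlocalForm b u u z - nonlocalForm b w w z)
      ((K + K' * R + |b| * K * R + |3 - b| * K') / δ * E) := by
  have hσR : σ ≤ R := by linarith
  have hs := strip_mono hσR
  have hs' := strip_mono hσ
  have hvd : DifferentiableOn ℂ (fun z => u z - w z) (strip (σ + δ)) := (hu.sub hw).mono hs'
  have hv0 : SupBound σ (fun z => u z - w z) E := hv.mono (by linarith) le_rfl
  have hv1 := hv.cauchy hvd hδ (le_refl (σ + δ))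
  have hder : ∀ z ∈ strip σ, deriv (fun z => u z - w z) z = deriv u z - deriv w z := fun z hz =>
    deriv_fun_sub (differentiableAt_of_mem_strip hu (hs hz))
      (differentiableAt_of_mem_strip hw (hs hz))
  have hER : E ≤ R * (E / δ) := by
    rw [mul_div_assoc', le_div_iff₀ hδ, mul_comm R]
    exact mul_le_mul_of_nonneg_left hδR hE
  have hsum : SupBound σ (fun z => u z + w z) (K + K) :=
    (huK.mono hσR le_rfl).add (hwK.mono hσR le_rfl)
  have hsum' : SupBound σ (fun z => deriv u z + deriv w z) (K' + K') :=
    (huK'.mono hσR le_rfl).add (hwK'.mono hσR le_rfl)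
  have hfu : SupBound σ (flux b u u) _ :=
    (SupBound.flux b huK huK huK' huK' hK hK').mono hσR le_rfl
  have hfw : SupBound σ (flux b w w) _ :=
    (SupBound.flux b hwK hwK hwK' hwK' hK hK').mono hσR le_rfl
  have hflux : SupBound σ (fun z => flux b u u z - flux b w w z)
      (|b| / 2 * ((K + K) * E) + |3 - b| / 2 * ((K' + K') * (E / δ))) := by
    have h1 := ((hsum.mul hv0 (by linarith)).const_mul ((b / 2 : ℝ) : ℂ)).add
      ((hsum'.mul hv1 (by linarith)).const_mul (((3 - b) / 2 : ℝ) : ℂ))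
    rw [norm_ofReal_half, norm_ofReal_half] at h1
    intro z hz
    refine le_of_eq_of_le ?_ (h1 z hz)
    simp only [hder z hz, flux]
    congr 1
    ring
  have hT : SupBound σ (fun z => u z * deriv u z - w z * deriv w z)
      (K * (E / δ) + K' * E) := by
    have h1 := ((huK.mono hσR le_rfl).mul hv1 hK).add ((hwK'.mono hσR le_rfl).mul hv0 hK')
    intro z hz
    refine le_of_eq_of_le ?_ (h1 z hz)
    simp only [hder z hz]
    congr 1
    ring
  intro z hz
  have h1 : nonlocalForm b u u z - nonlocalForm b w w z =
      -((u z * deriv u z - w z * deriv w z) +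
        dHelmInv (fun z => flux b u u z - flux b w w z) z) := by
    rw [dHelmInv_sub ((differentiableOn_flux b hu hu).mono hs)
      ((differentiableOn_flux b hw hw).mono hs) hfu hfw hz, nonlocalForm, nonlocalForm]
    ring
  simp only
  rw [h1, norm_neg]
  refine ((hT.add hflux.dHelmInv) z hz).trans ?_
  have e1 := mul_le_mul_of_nonneg_left hER hK'
  have e2 := mul_le_mul_of_nonneg_left hER (mul_nonneg (abs_nonneg b) hK)
  have e3 : (K + K' * R + |b| * K * R + |3 - b| * K') / δ * E =
    K * (E / δ) + K' * (R * (E / δ)) + |b| * K * (R * (E / δ)) + |3 - b| * K' * (E / δ) := by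
    ring
  rw [e3]
  linarith

/-- Local uniqueness in a scale of strips: a family `v` vanishing at time `t₀`, whose time
derivative is controlled by `v` itself with the loss `C / δ` for a loss `δ` of width, vanishes for a
short time. The estimate is iterated `N` times with `δ = R / (2 N)`, and `N → ∞`. -/
theorem eq_zero_of_scale_estimate {R C K t₀ t₁ : ℝ} {v vt : ℝ → ℂ → ℂ} (hR : 0 < R) (hC : 0 ≤ C)
    (hK : 0 ≤ K)
    (hcont : ∀ z ∈ strip R, ContinuousOn (fun s => v s z) (Set.Icc t₀ t₁))
    (hderiv : ∀ z ∈ strip R, ∀ s ∈ Set.Ico t₀ t₁,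
      HasDerivWithinAt (fun s => v s z) (vt s z) (Set.Ici s) s)
    (h0 : ∀ z ∈ strip R, v t₀ z = 0) (hvK : ∀ s ∈ Set.Icc t₀ t₁, SupBound R (v s) K)
    (hest : ∀ s ∈ Set.Icc t₀ t₁, ∀ σ δ E : ℝ, 0 < δ → δ ≤ R → σ + δ ≤ R → 0 ≤ E →
      SupBound (σ + δ) (v s) E → SupBound σ (vt s) (C / δ * E))
    {t : ℝ} (ht : t ∈ Set.Icc t₀ t₁) (hsmall : 6 * C * (t - t₀) < R) :
    ∀ z ∈ strip (R / 2), v t z = 0 := by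
  have iter : ∀ δ : ℝ, 0 < δ → δ ≤ R → ∀ n : ℕ, ∀ s ∈ Set.Icc t₀ t₁,
      SupBound (R - n * δ) (v s) (K * ((C / δ) ^ n * ((s - t₀) ^ n / n.factorial))) := by
    intro δ hδ hδR n
    induction n with
    | zero =>
      intro s hs
      simpa using hvK s hs
    | succ n ih =>
      intro s hs z hz
      have hσ : R - ((n + 1 : ℕ) : ℝ) * δ + δ = R - n * δ := by
        push_cast
        ring
      have hzR : z ∈ strip R := strip_mono (by
        have : 0 ≤ ((n + 1 : ℕ) : ℝ) * δ := by positivity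
        linarith) hz
      have hCδ : 0 ≤ C / δ := div_nonneg hC hδ.le
      refine image_norm_le_of_norm_deriv_right_le_deriv_boundary
        (f := fun s => v s z) (f' := fun s => vt s z) (hcont z hzR) (hderiv z hzR)
        (B := fun s => K * ((C / δ) ^ (n + 1) * ((s - t₀) ^ (n + 1) / (n + 1).factorial)))
        (B' := fun s => C / δ * (K * ((C / δ) ^ n * ((s - t₀) ^ n / n.factorial))))
        ?_ ?_ ?_ hs
      · rw [h0 z hzR]
        simp
      · intro x
        have hd : HasDerivAt (fun s => (s - t₀) ^ (n + 1))
            (((n + 1 : ℕ) : ℝ) * (x - t₀) ^ n * 1) x := by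
          simpa using ((hasDerivAt_id x).sub_const t₀).fun_pow (n + 1)
        refine (((hd.div_const ((n + 1).factorial : ℝ)).const_mul
          ((C / δ) ^ (n + 1))).const_mul K).congr_deriv ?_
        rw [Nat.factorial_succ]
        push_cast
        rw [pow_succ (C / δ)]
        field_simp
      · intro x hx
        have hx' : x ∈ Set.Icc t₀ t₁ := Set.Ico_subset_Icc_self hx
        refine hest x hx' _ δ _ hδ hδR ?_ ?_ ?_ z hz
        · rw [hσ]
          have : 0 ≤ (n : ℝ) * δ := by positivity
          linarith
        · have : 0 ≤ x - t₀ := sub_nonneg.2 hx.1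
          positivity
        · rw [hσ]
          exact ih x hx'
  intro z hz
  have htt : 0 ≤ t - t₀ := sub_nonneg.2 ht.1
  set r := 6 * C * (t - t₀) / R with hr
  have hr0 : 0 ≤ r := by positivity
  have hr1 : r < 1 := (div_lt_one hR).2 hsmall
  have hbound : ∀ n : ℕ, ‖v t z‖ ≤ K * r ^ (n + 1) := by
    intro n
    have hN : (0 : ℝ) < ((n + 1 : ℕ) : ℝ) := by positivity
    have hN1 : (1 : ℝ) ≤ ((n + 1 : ℕ) : ℝ) := by exact_mod_cast Nat.succ_pos n
    have hδ : 0 < R / (2 * ((n + 1 : ℕ) : ℝ)) := by positivity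
    have hδR : R / (2 * ((n + 1 : ℕ) : ℝ)) ≤ R := div_le_self hR.le (by linarith)
    have hRN : R - ((n + 1 : ℕ) : ℝ) * (R / (2 * ((n + 1 : ℕ) : ℝ))) = R / 2 := by
      field_simp
      ring
    have h1 := iter _ hδ hδR (n + 1) t ht z (by rw [hRN]; exact hz)
    refine h1.trans (mul_le_mul_of_nonneg_left ?_ hK)
    -- Stirling in the crude form `Nᴺ / N! ≤ eᴺ ≤ 3ᴺ`
    have h2 := Real.pow_div_factorial_le_exp ((n + 1 : ℕ) : ℝ) hN.le (n + 1)
    have h3 : Real.exp ((n + 1 : ℕ) : ℝ) ≤ 3 ^ (n + 1) := by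
      rw [← mul_one ((n + 1 : ℕ) : ℝ), Real.exp_nat_mul]
      exact pow_le_pow_left₀ (Real.exp_pos _).le Real.exp_one_lt_three.le _
    calc (C / (R / (2 * ((n + 1 : ℕ) : ℝ)))) ^ (n + 1) *
          ((t - t₀) ^ (n + 1) / (n + 1).factorial)
        = (2 * C * (t - t₀) / R) ^ (n + 1) *
          (((n + 1 : ℕ) : ℝ) ^ (n + 1) / (n + 1).factorial) := by
          rw [mul_div_assoc', mul_div_assoc', ← mul_pow, ← mul_pow]
          congr 2
          field_simp
      _ ≤ (2 * C * (t - t₀) / R) ^ (n + 1) * 3 ^ (n + 1) :=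
          mul_le_mul_of_nonneg_left (h2.trans h3) (by positivity)
      _ = r ^ (n + 1) := by
          rw [← mul_pow, hr]
          congr 1
          ring
  have hlim : Tendsto (fun n : ℕ => K * r ^ (n + 1)) atTop (𝓝 0) := by
    simpa using ((tendsto_pow_atTop_nhds_zero_of_lt_one hr0 hr1).comp
      (tendsto_add_atTop_nat 1)).const_mul K
  exact norm_le_zero_iff.1 (ge_of_tendsto' hlim hbound)

/-- Two solutions that agree at a time `t₀ < T` agree for a short time after `t₀`. -/
theorem exists_eqOn_of_eqOn {b ρ T t₀ : ℝ} {u ut w wt : ℝ → ℂ → ℂ} (hρ : 0 < ρ)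
    (hu : IsC1InTime 1 ρ T u ut) (hub : SolvesBFamily b ρ T u ut)
    (hw : IsC1InTime 1 ρ T w wt) (hwb : SolvesBFamily b ρ T w wt)
    (ht₀ : t₀ ∈ Set.Ico 0 T) (h0 : Set.EqOn (u t₀) (w t₀) (strip ρ)) :
    ∃ t₁ ∈ Set.Ioc t₀ T, ∀ t ∈ Set.Icc t₀ t₁, Set.EqOn (u t) (w t) (strip ρ) := by
  have ht₀' : t₀ ∈ Set.Icc 0 T := Set.Ico_subset_Icc_self ht₀
  obtain ⟨η₁, hη₁, K₁, hK₁, hb₁⟩ := hu.exists_supBound ht₀'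
  obtain ⟨η₂, hη₂, K₂, hK₂, hb₂⟩ := hw.exists_supBound ht₀'
  set K := max K₁ K₂ with hKdef
  have hK : 0 ≤ K := hK₁.trans (le_max_left _ _)
  set R := ρ / 2 with hR
  have hR0 : 0 < R := half_pos hρ
  have hRρ : R + R ≤ ρ := by rw [hR]; linarith
  have hs := strip_mono (show R ≤ ρ by linarith)
  set K' := K / R with hK'def
  have hK' : 0 ≤ K' := div_nonneg hK hR0.le
  set C := K + K' * R + |b| * K * R + |3 - b| * K' with hCdef
  have hC : 0 ≤ C := by positivity
  -- a time step on which the bounds hold and the iteration converges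
  obtain ⟨τ, hτ, hτ1, hτ2, hτ3, hτ4⟩ :
      ∃ τ > 0, τ < η₁ ∧ τ < η₂ ∧ τ ≤ T - t₀ ∧ 6 * C * τ < R := by
    have hq : 0 < R / (6 * C + 1) := by positivity
    have hm : 0 < min (min η₁ η₂) (min (T - t₀) (R / (6 * C + 1))) :=
      lt_min (lt_min hη₁ hη₂) (lt_min (sub_pos.2 ht₀.2) hq)
    refine ⟨min (min η₁ η₂) (min (T - t₀) (R / (6 * C + 1))) / 2, half_pos hm, ?_, ?_, ?_, ?_⟩
    · exact (half_lt_self hm).trans_le ((min_le_left _ _).trans (min_le_left _ _))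
    · exact (half_lt_self hm).trans_le ((min_le_left _ _).trans (min_le_right _ _))
    · exact (half_lt_self hm).le.trans ((min_le_right _ _).trans (min_le_left _ _))
    · have h1 : min (min η₁ η₂) (min (T - t₀) (R / (6 * C + 1))) / 2 < R / (6 * C + 1) :=
        (half_lt_self hm).trans_le ((min_le_right _ _).trans (min_le_right _ _))
      rw [lt_div_iff₀ (by positivity)] at h1
      nlinarith [half_pos hm]
  have hsub : Set.Icc t₀ (t₀ + τ) ⊆ Set.Icc 0 T := fun s hs =>
    ⟨ht₀.1.trans hs.1, hs.2.trans (by linarith)⟩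
  have habs : ∀ s ∈ Set.Icc t₀ (t₀ + τ), |s - t₀| ≤ τ := fun s hs => by
    rw [abs_of_nonneg (sub_nonneg.2 hs.1)]
    linarith [hs.2]
  have huK : ∀ s ∈ Set.Icc t₀ (t₀ + τ), SupBound ρ (u s) K := fun s hs =>
    (hb₁ s (hsub hs) ((habs s hs).trans_lt hτ1)).mono le_rfl (le_max_left _ _)
  have hwK : ∀ s ∈ Set.Icc t₀ (t₀ + τ), SupBound ρ (w s) K := fun s hs =>
    (hb₂ s (hsub hs) ((habs s hs).trans_lt hτ2)).mono le_rfl (le_max_right _ _)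
  have hud : ∀ s ∈ Set.Icc t₀ (t₀ + τ), DifferentiableOn ℂ (u s) (strip ρ) := fun s hs =>
    (hu.mem s (hsub hs)).exists_h1Bound.diff
  have hwd : ∀ s ∈ Set.Icc t₀ (t₀ + τ), DifferentiableOn ℂ (w s) (strip ρ) := fun s hs =>
    (hw.mem s (hsub hs)).exists_h1Bound.diff
  refine ⟨t₀ + τ, ⟨by linarith, by linarith⟩, fun t ht => ?_⟩
  have hzero : ∀ z ∈ strip (R / 2), u t z - w t z = 0 := by
    refine eq_zero_of_scale_estimate (v := fun s z => u s z - w s z)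
      (vt := fun s z => ut s z - wt s z) (t₁ := t₀ + τ) (K := K + K) hR0 hC (by linarith)
      (fun z hz s hs => ?_) (fun z hz s hs => ?_) (fun z hz => sub_eq_zero.2 (h0 (strip_mono
        (by linarith) hz))) (fun s hs' z hz => ?_) (fun s hs' σ δ E hδ hδR hσ hE hv z hz => ?_)
      ht ?_
    · exact (((hu.hasDerivWithinAt (hsub hs) (strip_mono (by linarith) hz)).fun_sub
        (hw.hasDerivWithinAt (hsub hs) (strip_mono (by linarith) hz))).continuousWithinAt).mono
          hsub
    · have hs' := Set.Ico_subset_Icc_self hs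
      refine ((hu.hasDerivWithinAt (hsub hs') (strip_mono (by linarith) hz)).fun_sub
        (hw.hasDerivWithinAt (hsub hs') (strip_mono (by linarith) hz))).mono_of_mem_nhdsWithin ?_
      refine Filter.mem_of_superset (Icc_mem_nhdsGE hs.2) fun x hx => ?_
      exact hsub ⟨hs.1.trans hx.1, hx.2⟩
    · exact (norm_sub_le _ _).trans (add_le_add (huK s hs' z (hs hz)) (hwK s hs' z (hs hz)))
    · have hu1 : SupBound R (deriv (u s)) K' := (huK s hs').cauchy (hud s hs') hR0 hRρ
      have hw1 : SupBound R (deriv (w s)) K' := (hwK s hs').cauchy (hwd s hs') hR0 hRρ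
      have hu0 : SupBound R (u s) K := (huK s hs').mono (by linarith) le_rfl
      have hw0 : SupBound R (w s) K := (hwK s hs').mono (by linarith) le_rfl
      have hut := (hu.mem_deriv s (hsub hs')).exists_h1Bound.mono (show R ≤ ρ by linarith) le_rfl
      have hwt := (hw.mem_deriv s (hsub hs')).exists_h1Bound.mono (show R ≤ ρ by linarith) le_rfl
      have hzR : z ∈ strip R := strip_mono (by linarith) hz
      have eu := eq_nonlocalForm ((hud s hs').mono hs) hut.diff hu0 hu1 hK hK' hut.supBound
        (fun z hz => hub s (hsub hs') z (hs hz)) z hzR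
      have ew := eq_nonlocalForm ((hwd s hs').mono hs) hwt.diff hw0 hw1 hK hK' hwt.supBound
        (fun z hz => hwb s (hsub hs') z (hs hz)) z hzR
      simp only
      rw [eu, ew]
      exact supBound_nonlocalForm_sub ((hud s hs').mono hs) ((hwd s hs').mono hs) hu0 hw0 hu1 hw1
        hK hK' hδ hδR hσ hE hv z hz
    · refine lt_of_le_of_lt (mul_le_mul_of_nonneg_left ?_ (by positivity)) hτ4
      linarith [ht.2]
  have h0mem : ∀ {r : ℝ}, 0 < r → (0 : ℂ) ∈ strip r := fun hr => by simpa [strip] using hr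
  refine AnalyticOnNhd.eqOn_of_preconnected_of_eventuallyEq
    ((hud t ht).analyticOnNhd (isOpen_strip ρ)) ((hwd t ht).analyticOnNhd (isOpen_strip ρ))
    (isPreconnected_strip ρ) (h0mem hρ) ?_
  filter_upwards [(isOpen_strip (R / 2)).mem_nhds (h0mem (half_pos hR0))] with z hz
  exact sub_eq_zero.1 (hzero z hz)

/-- Uniqueness for the Cauchy problem on any time interval: the set of times up to which two
solutions agree is closed and open to the right. -/
theorem eqOn_of_isSolution {b ρ T : ℝ} {u₀ : ℂ → ℂ} {u w : ℝ → ℂ → ℂ} (hρ : 0 < ρ)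
    (hu : IsSolution b ρ T u₀ u) (hw : IsSolution b ρ T u₀ w) :
    ∀ t ∈ Set.Icc 0 T, Set.EqOn (u t) (w t) (strip ρ) := by
  obtain ⟨ut, hu1, hu2, hu3⟩ := hu
  obtain ⟨wt, hw1, hw2, hw3⟩ := hw
  have hclosed : IsClosed ({t | Set.EqOn (u t) (w t) (strip ρ)} ∩ Set.Icc 0 T) := by
    have h1 : {t | Set.EqOn (u t) (w t) (strip ρ)} ∩ Set.Icc 0 T =
        Set.Icc 0 T ∩ ⋂ z ∈ strip ρ, Set.Icc 0 T ∩ (fun t => u t z - w t z) ⁻¹' {0} := by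
      ext t
      simp only [Set.mem_inter_iff, Set.mem_ofPred_eq, Set.mem_iInter, Set.mem_preimage,
        Set.mem_singleton_iff, sub_eq_zero]
      exact ⟨fun h => ⟨h.2, fun z hz => ⟨h.2, h.1 hz⟩⟩, fun h => ⟨fun z hz => (h.2 z hz).2, h.1⟩⟩
    rw [h1]
    refine isClosed_Icc.inter (isClosed_biInter fun z hz => ?_)
    refine ContinuousOn.preimage_isClosed_of_isClosed (fun t ht => ?_) isClosed_Icc
      isClosed_singleton
    exact ((hu1.hasDerivWithinAt ht hz).fun_sub (hw1.hasDerivWithinAt ht hz)).continuousWithinAt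
  refine hclosed.Icc_subset_of_forall_exists_gt (fun z hz => (hu3 hz).trans (hw3 hz).symm) ?_
  rintro t₀ ⟨h0, ht₀⟩ y hy
  obtain ⟨t₁, ht₁, h⟩ := exists_eqOn_of_eqOn hρ hu1 hu2 hw1 hw2 ht₀ h0
  have hty : t₀ < y := hy
  exact ⟨min t₁ y, h _ ⟨le_min ht₁.1.le hty.le, min_le_left _ _⟩,
    lt_min ht₁.1 hty, min_le_right _ _⟩

end BFamily

theorem theorem2 (b ρ₀ : ℝ) (hρ₀ : 0 < ρ₀) (u₀ : ℂ → ℂ) (hu₀ : BFamily.MemH 1 ρ₀ u₀) :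
    ∃ β : ℝ, 0 < β ∧ ∀ ρ : ℝ, 0 < ρ → ρ < ρ₀ →
      (∃ u : ℝ → ℂ → ℂ, BFamily.IsSolution b ρ ((ρ₀ - ρ) / β) u₀ u) ∧
      (∀ u w : ℝ → ℂ → ℂ,
        BFamily.IsSolution b ρ ((ρ₀ - ρ) / β) u₀ u →
        BFamily.IsSolution b ρ ((ρ₀ - ρ) / β) u₀ w →
        ∀ t ∈ Set.Icc 0 ((ρ₀ - ρ) / β), Set.EqOn (u t) (w t) (BFamily.strip ρ)) := by
  -- adding `1` keeps the bound, and with it `β`, positive when `u₀` vanishes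
  have hM : 0 < (BFamily.hNorm 1 ρ₀ u₀).toReal + 1 := by positivity
  have hb := hu₀.exists_h1Bound.mono le_rfl (le_add_of_nonneg_right zero_le_one)
  refine ⟨16 * BFamily.growthConst b ρ₀ ((BFamily.hNorm 1 ρ₀ u₀).toReal + 1), ?_,
    fun ρ hρ hρρ₀ => ⟨BFamily.exists_isSolution hρ₀ hM hb hρ hρρ₀, fun u w hu hw =>
      BFamily.eqOn_of_isSolution hρ hu hw⟩⟩
  have := BFamily.formConst_pos b
  unfold BFamily.growthConst
  positivity
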